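/- All graphs are finite, simple and undirected, and may carry a vertex colouring (an uncoloured graph is one in which all vertices have the same colour); isomorphisms of coloured graphs preserve the colours. For a graph $G$ and $X\subseteq V(G)$ let $\rho_G(X)$ be the rank over $\mathbb F_2$ of the $X\times (V(G)\setminus X)$ matrix whose $(x,y)$ entry is $1$ if $xy\in E(G)$ and $0$ otherwise. A rank decomposition of $G$ is a rooted binary tree $T$ (every internal node has exactly two children) together with sets $\gamma(t)\subseteq V(G)$ for $t\in V(T)$ such that $\gamma(r)=V(G)$ for the root $r$, $\gamma(t)$ is the disjoint union of $\gamma(s_1)$ and $\gamma(s_2)$ for every internal node $t$ with children $s_1,s_2$, and $|\gamma(t)|=1$ for every leaf $t$. Its width is $\max_{t\in V(T)}\rho_G(\gamma(t))$, and the rank width of $G$ is the minimum width of a rank decomposition of $G$ (and $0$ if $G$ has no vertices). For $\ell\ge 2$, the $\ell$-dimensional Weisfeiler–Leman algorithm colours the $\ell$-tuples of vertices of the two input graphs $G,H$. The initial colour of $(v_1,\dots,v_\ell)$ consists of the vertex colours of the $v_a$ and of the information for which $a,b$ one has $v_a=v_b$ and for which $a,b$ the vertices $v_a,v_b$ are adjacent.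 In round $i+1$ the colour $\chi_i(\bar v)$ is replaced by $\chi_{i+1}(\bar v)=\bigl(\chi_i(\bar v);\{\!\!\{(\chi_i(\bar v[w/1]),\dots,\chi_i(\bar v[w/\ell])) : w\in V\}\!\!\}\bigr)$, where $V$ is the vertex set of the graph of $\bar v$ and $\bar v[w/a]$ arises from $\bar v$ by replacing the $a$-th entry by $w$. The process stops at the first round $i$ for which $\chi_{i+1}$ does not properly refine the partition that $\chi_i$ induces on the $\ell$-tuples of the two graphs. The algorithm distinguishes $G$ and $H$ if in the colouring of that round some colour occurs a different number of times on the $\ell$-tuples of $G$ and on those of $H$. It identifies $G$ if it distinguishes $G$ from every graph $H$ that is not isomorphic to $G$. **Theorem.** For every $k\ge 0$, the $(3k+4)$-dimensional Weisfeiler–Leman algorithm identifies every (vertex-coloured) graph of rank width at most $k$. -/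

import Mathlib

universe u v w

/-! ## Rank width -/

open Classical in
/-- The cut rank `ρ_G(X)`: the rank over the field with two elements of the matrix whose rows are
indexed by `X`, whose columns are indexed by the complement of `X`, and whose `(x, y)` entry is `1`
exactly if `xy` is an edge. -/
noncomputable def cutRank {V : Type u} [Fintype V] (G : SimpleGraph V) (X : Set V) : ℕ :=
  (Matrix.of fun (x : X) (y : (Xᶜ : Set V)) =>
    if G.Adj (x : V) (y : V) then (1 : ZMod 2) else 0).rank

/-- `DecompositionTree X` is the type of rooted binary trees (every internal node has exactly two
children), every node `t` of which carries a vertex set `γ(t)`, such that the root carries `X`, the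
set at an internal node is the disjoint union of the sets at its two children, and the sets at the
leaves are singletons. -/
inductive DecompositionTree {V : Type u} : Set V → Type u
  | leaf (x : V) : DecompositionTree {x}
  | node {X₁ X₂ : Set V} (t₁ : DecompositionTree X₁) (t₂ : DecompositionTree X₂)
      (h : Disjoint X₁ X₂) : DecompositionTree (X₁ ∪ X₂)

/-- The width of a decomposition tree: the maximum of `ρ_G(γ(t))` over all nodes `t`. -/
noncomputable def DecompositionTree.width {V : Type u} [Fintype V] (G : SimpleGraph V) :
    {X : Set V} → DecompositionTree X → ℕ
  | _, .leaf x => cutRank G {x}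
  | _, .node (X₁ := X₁) (X₂ := X₂) t₁ t₂ _ =>
      max (cutRank G (X₁ ∪ X₂)) (max (t₁.width G) (t₂.width G))

/-- The rank width of a finite graph: the minimum width of a rank decomposition, that is, of a
decomposition tree whose root carries the whole vertex set. Every graph with at least one vertex
has a rank decomposition; the graph without vertices has none, and its rank width is `0`. -/
noncomputable def rankWidth {V : Type u} [Fintype V] (G : SimpleGraph V) : ℕ :=
  sInf {m : ℕ | ∃ T : DecompositionTree (Set.univ : Set V), T.width G = m}

/-! ## The Weisfeiler-Leman algorithm (dimension `ℓ ≥ 2`) -/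

/-- The colours that the `ℓ`-dimensional algorithm uses in round `i`, for vertex colours in `C`.
An initial colour is an isomorphism type of an ordered coloured graph on an `ℓ`-tuple: the vertex
colours, the equality pattern and the adjacency pattern. A colour of round `i + 1` is a pair of
a colour of round `i` and a multiset of `ℓ`-tuples of colours of round `i`. -/
def WLColour (C : Type w) (ℓ : ℕ) : ℕ → Type w
  | 0 => (Fin ℓ → C) × (Fin ℓ → Fin ℓ → Prop) × (Fin ℓ → Fin ℓ → Prop)
  | i + 1 => WLColour C ℓ i × Multiset (Fin ℓ → WLColour C ℓ i)

/-- The colouring of the `ℓ`-tuples of vertices of the coloured graph `(G, χ)` after `i` rounds. -/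
def wlColouring {V : Type u} {C : Type w} [Fintype V] (ℓ : ℕ) (G : SimpleGraph V) (χ : V → C) :
    (i : ℕ) → (Fin ℓ → V) → WLColour C ℓ i
  | 0, x => (fun a => χ (x a), fun a b => x a = x b, fun a b => G.Adj (x a) (x b))
  | i + 1, x => (wlColouring ℓ G χ i x,
      (Finset.univ : Finset V).val.map fun y a => wlColouring ℓ G χ i (Function.update x a y))

section Pair

variable {V : Type u} {W : Type v} {C : Type w} [Fintype V] [Fintype W]

/-- The colouring after `i` rounds of the `ℓ`-tuples of both input graphs. -/
def wlPairColouring (ℓ : ℕ) (G : SimpleGraph V) (χ : V → C) (H : SimpleGraph W) (ψ : W → C)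
    (i : ℕ) : (Fin ℓ → V) ⊕ (Fin ℓ → W) → WLColour C ℓ i :=
  Sum.elim (wlColouring ℓ G χ i) (wlColouring ℓ H ψ i)

/-- Round `i + 1` does not strictly refine the partition, obtained in round `i`, of the `ℓ`-tuples
of the two input graphs. -/
def WLStableAt (ℓ : ℕ) (G : SimpleGraph V) (χ : V → C) (H : SimpleGraph W) (ψ : W → C)
    (i : ℕ) : Prop :=
  ∀ p q : (Fin ℓ → V) ⊕ (Fin ℓ → W),
    wlPairColouring ℓ G χ H ψ i p = wlPairColouring ℓ G χ H ψ i q →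
      wlPairColouring ℓ G χ H ψ (i + 1) p = wlPairColouring ℓ G χ H ψ (i + 1) q

theorem wlPairColouring_of_succ (ℓ : ℕ) (G : SimpleGraph V) (χ : V → C) (H : SimpleGraph W)
    (ψ : W → C) (i : ℕ) (p q : (Fin ℓ → V) ⊕ (Fin ℓ → W))
    (h : wlPairColouring ℓ G χ H ψ (i + 1) p = wlPairColouring ℓ G χ H ψ (i + 1) q) :
    wlPairColouring ℓ G χ H ψ i p = wlPairColouring ℓ G χ H ψ i q := by
  rcases p with p | p <;> rcases q with q | q <;> exact congrArg Prod.fst h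

/-- The refinement process stops. -/
theorem exists_wlStableAt (ℓ : ℕ) (G : SimpleGraph V) (χ : V → C) (H : SimpleGraph W)
    (ψ : W → C) : ∃ i, WLStableAt ℓ G χ H ψ i := by
  let S : ℕ → Set (((Fin ℓ → V) ⊕ (Fin ℓ → W)) × ((Fin ℓ → V) ⊕ (Fin ℓ → W))) := fun i =>
    {p | wlPairColouring ℓ G χ H ψ i p.1 = wlPairColouring ℓ G χ H ψ i p.2}
  obtain ⟨i, hi⟩ : ∃ i, ∀ j, (S i).ncard ≤ (S j).ncard :=
    ⟨Function.argmin fun i => (S i).ncard, fun j => Function.argmin_le (fun i => (S i).ncard) j⟩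
  refine ⟨i, fun p q hpq => ?_⟩
  have hsub : S (i + 1) ⊆ S i := fun x hx => wlPairColouring_of_succ ℓ G χ H ψ i x.1 x.2 hx
  have heq : S (i + 1) = S i := Set.eq_of_subset_of_ncard_le hsub (hi (i + 1)) (Set.toFinite _)
  have hmem : (p, q) ∈ S (i + 1) := by
    rw [heq]
    exact hpq
  exact hmem

open Classical in
/-- The first round after which the partition of the `ℓ`-tuples of the two input graphs is
stable. -/
noncomputable def wlStableRound (ℓ : ℕ) (G : SimpleGraph V) (χ : V → C) (H : SimpleGraph W)
    (ψ : W → C) : ℕ :=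
  Nat.find (exists_wlStableAt ℓ G χ H ψ)

/-- The `ℓ`-dimensional Weisfeiler-Leman algorithm distinguishes `(G, χ)` and `(H, ψ)`: in the
stable colouring some colour occurs a different number of times on the `ℓ`-tuples of `G` and on
those of `H`. -/
def WLDistinguishes (ℓ : ℕ) (G : SimpleGraph V) (χ : V → C) (H : SimpleGraph W) (ψ : W → C) :
    Prop :=
  ∃ c : WLColour C ℓ (wlStableRound ℓ G χ H ψ),
    Set.ncard {x : Fin ℓ → V | wlColouring ℓ G χ (wlStableRound ℓ G χ H ψ) x = c} ≠
      Set.ncard {y : Fin ℓ → W | wlColouring ℓ H ψ (wlStableRound ℓ G χ H ψ) y = c}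

end Pair

/-- Isomorphism of vertex-coloured graphs. -/
def ColouredIso {V : Type u} {W : Type v} {C : Type w} (G : SimpleGraph V) (χ : V → C)
    (H : SimpleGraph W) (ψ : W → C) : Prop :=
  ∃ φ : G ≃g H, ∀ x : V, ψ (φ x) = χ x

/-- The `ℓ`-dimensional Weisfeiler-Leman algorithm identifies `(G, χ)`: it distinguishes it from
every finite coloured graph that is not isomorphic to it. -/
def WLIdentifies {V : Type u} {C : Type w} [Fintype V] (ℓ : ℕ) (G : SimpleGraph V) (χ : V → C) :
    Prop :=
  ∀ (W : Type v) [Fintype W] (H : SimpleGraph W) (ψ : W → C),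
    ¬ ColouredIso G χ H ψ → WLDistinguishes ℓ G χ H ψ

/-! ## Cuts over the field with two elements -/

/-! Let `X` be the set of a node. Choose families `a` in `X` and `b` outside `X`, of at most `k`
vertices each, whose rows and columns span the cut matrix. Then a matrix `L` writes the cut matrix
as a bilinear expression in the adjacencies to `b` and to `a` (`exists_flipBit_eq_adjBit`), and this
expression makes sense for all pairs of vertices. Draw an arc wherever adjacency disagrees with it.
No arc leaves `X`, so strong components of vertices of `X` lie in `X`. Between two different strong
components arcs run in at most one direction, and adjacency is determined by the bilinear expression
together with the numbers of reachable vertices (`adjBit_eq_of_notMem_flipBlock`). The set `X`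
itself is invisible to the algorithm, but the digraph is visible as soon as `a` and `b` are entries
of a tuple, because paths can be traced with a further entry
(`IsStablePair.flipReach_of_flipReach`).

The claim proved along the tree is that the stable colour of a tuple containing `a`, `b` and a
vertex of `X` determines the strong component of that vertex up to isomorphism. For `X = X₁ ∪ X₂`
the family `a` is drawn from `a₁` and `a₂`, and the families outside `X₁` and `X₂` are drawn from
`a₂, b` and `a₁, b`. So three families of `k` entries carry all three cuts; the four further entries
hold a centre, the vertices under comparison and the vertex that walks along paths.

An arc of the first child's digraph that starts in `X₁` is an arc of the parent's digraph or ends at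
an out-neighbour of some `a₁ i` (`flipArc_of_flipArc_subset`), and likewise for the second child.
Hence the set reachable from the centre, `a₁` and `a₂` splits into components for the children.
Membership in `X₁` is replaced by having the type of some vertex of `X₁`. Components around vertices
of equal type are isomorphic by induction, every type occurs equally often in both graphs, so
`exists_glue` assembles one bijection, and adjacency between different pieces is forced
(`NiceCuts.isoAt_centre`). At the root the bilinear expression vanishes, the strong components are
the connected components, and gluing them gives the isomorphism (`colouredIso_of_isStablePair`). -/

open Classical in
/-- The adjacency matrix of `G` over the field with two elements. -/
noncomputable def adjBit {V : Type u} (G : SimpleGraph V) (x y : V) : ZMod 2 :=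
  if G.Adj x y then 1 else 0

theorem adjBit_comm {V : Type u} (G : SimpleGraph V) (x y : V) : adjBit G x y = adjBit G y x := by
  unfold adjBit
  rw [G.adj_comm]

theorem adjBit_eq_adjBit_iff {V : Type u} {W : Type v} {G : SimpleGraph V} {H : SimpleGraph W}
    {x y : V} {x' y' : W} :
    adjBit G x y = adjBit H x' y' ↔ (G.Adj x y ↔ H.Adj x' y') := by
  unfold adjBit
  by_cases h : G.Adj x y <;> by_cases h' : H.Adj x' y' <;> simp [h, h']

/-- The rows of the cut matrix of `X` that belong to the vertices `a i` of `X` span its row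
space. -/
def SpansCut {V : Type u} {ι : Type*} [Fintype ι] (G : SimpleGraph V) (a : ι → V) (X : Set V) :
    Prop :=
  ∀ x ∈ X, ∃ p : ι → ZMod 2, ∀ y ∉ X, adjBit G x y = ∑ i, p i * adjBit G (a i) y

theorem exists_fin_span {K E : Type*} [Field K] [AddCommGroup E] [Module K E] {ι : Type*}
    [Finite ι] (r : ι → E) (k : ℕ) (hk : Module.finrank K (Submodule.span K (Set.range r)) ≤ k)
    (hι : 0 < k → Nonempty ι) :
    ∃ τ : Fin k → ι, ∀ t, r t ∈ Submodule.span K (Set.range (r ∘ τ)) := by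
  have : FiniteDimensional K (Submodule.span K (Set.range r)) :=
    FiniteDimensional.span_of_finite K (Set.finite_range r)
  obtain ⟨f, hf, hspan, -⟩ := Submodule.exists_fun_fin_finrank_span_eq K (Set.range r)
  choose g hg using hf
  rcases Nat.eq_zero_or_pos k with rfl | hpos
  · refine ⟨Fin.elim0, fun t => ?_⟩
    have h0 : Submodule.span K (Set.range r) = ⊥ := Submodule.finrank_eq_zero.mp (by omega)
    have ht : r t ∈ Submodule.span K (Set.range r) := Submodule.subset_span ⟨t, rfl⟩
    rw [h0, Submodule.mem_bot] at ht
    rw [ht]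
    exact Submodule.zero_mem _
  · obtain ⟨t₀⟩ := hι hpos
    -- The rank may be smaller than `k`; the remaining places are filled with the arbitrary index
    -- `t₀`.
    refine ⟨fun i => if h : (i : ℕ) < _ then g ⟨i, h⟩ else t₀, fun t => ?_⟩
    have ht : r t ∈ Submodule.span K (Set.range r) := Submodule.subset_span ⟨t, rfl⟩
    rw [← hspan] at ht
    refine Submodule.span_mono ?_ ht
    rintro _ ⟨j, rfl⟩
    refine ⟨⟨j, lt_of_lt_of_le j.2 hk⟩, ?_⟩
    simp [hg]

open Classical in
/-- A spanning family can be thinned out to any length that is at least the rank. -/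
theorem SpansCut.exists_fin {V : Type u} [Fintype V] {ι : Type*} [Fintype ι] {G : SimpleGraph V}
    {s : ι → V} {X : Set V} (h : SpansCut G s X) (hs : ∀ t, s t ∈ X) {k : ℕ}
    (hk : cutRank G X ≤ k)
    (hι : 0 < k → Nonempty ι) : ∃ τ : Fin k → ι, SpansCut G (s ∘ τ) X := by
  let A : Matrix X (Xᶜ : Set V) (ZMod 2) := Matrix.of fun x y => adjBit G x y
  let r : ι → ((Xᶜ : Set V) → ZMod 2) := fun t => A ⟨s t, hs t⟩
  have hle : Submodule.span (ZMod 2) (Set.range r) ≤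
      Submodule.span (ZMod 2) (Set.range A.row) := by
    apply Submodule.span_mono
    rintro _ ⟨t, rfl⟩
    exact ⟨⟨s t, hs t⟩, rfl⟩
  have hrank : Module.finrank (ZMod 2) (Submodule.span (ZMod 2) (Set.range r)) ≤ k := by
    refine le_trans (Submodule.finrank_mono hle) ?_
    rw [← Matrix.rank_eq_finrank_span_row]
    exact hk
  obtain ⟨τ, hτ⟩ := exists_fin_span r k hrank hι
  refine ⟨τ, fun x hx => ?_⟩
  obtain ⟨p, hp⟩ := h x hx
  have hmem : A ⟨x, hx⟩ ∈ Submodule.span (ZMod 2) (Set.range (r ∘ τ)) := by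
    have : A ⟨x, hx⟩ = ∑ t, p t • r t := by
      ext y
      rw [Finset.sum_apply]
      exact hp y y.2
    rw [this]
    exact Submodule.sum_mem _ fun t _ => Submodule.smul_mem _ _ (hτ t)
  obtain ⟨q, hq⟩ := (Submodule.mem_span_range_iff_exists_fun (ZMod 2)).mp hmem
  refine ⟨q, fun y hy => ?_⟩
  have := congrFun hq ⟨y, hy⟩
  rw [Finset.sum_apply] at this
  exact this.symm

theorem rank_cut_compl {V : Type u} (G : SimpleGraph V) (X : Set V) {i₁ : Fintype (Xᶜ : Set V)}
    {i₂ : Fintype (Xᶜᶜ : Set V)} [Fintype X] :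
    (Matrix.of fun (x : (Xᶜ : Set V)) (y : (Xᶜᶜ : Set V)) => adjBit G x y).rank =
      (Matrix.of fun (x : X) (y : (Xᶜ : Set V)) => adjBit G x y).rank := by
  rw [← Matrix.rank_transpose (Matrix.of fun (x : X) (y : (Xᶜ : Set V)) => adjBit G x y),
    ← Matrix.rank_submatrix (Matrix.transpose _) (Equiv.refl _)
      (Equiv.setCongr (compl_compl X))]
  congr 1
  ext x y
  exact adjBit_comm G _ _

theorem cutRank_compl {V : Type u} [Fintype V] (G : SimpleGraph V) (X : Set V) :
    cutRank G Xᶜ = cutRank G X := by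
  classical
  exact rank_cut_compl G X

/-- The bilinear expression that agrees with the adjacency matrix across a cut with spanning
families `a` and `b`. -/
noncomputable def flipBit {V : Type u} {k m : ℕ} (G : SimpleGraph V) (a : Fin k → V)
    (b : Fin m → V) (L : Matrix (Fin m) (Fin k) (ZMod 2)) (x y : V) : ZMod 2 :=
  ∑ i, (∑ j, adjBit G x (b j) * L j i) * adjBit G (a i) y

/-- A linear section of `Q` over its range, extended to the whole space, serves as `L`. -/
theorem exists_generalized_inverse {K : Type*} [Field K] {k m : ℕ}
    (Q : Matrix (Fin k) (Fin m) K) : ∃ L : Matrix (Fin m) (Fin k) K, Q * L * Q = Q := by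
  let f := Matrix.toLin' Q
  obtain ⟨s, hs⟩ := f.rangeRestrict.exists_rightInverse_of_surjective f.range_rangeRestrict
  obtain ⟨g, hg⟩ := LinearMap.exists_extend s
  refine ⟨LinearMap.toMatrix' g, ?_⟩
  apply Matrix.toLin'.injective
  rw [Matrix.toLin'_mul, Matrix.toLin'_mul, Matrix.toLin'_toMatrix']
  ext1 x
  ext1
  have h1 : g (f (Pi.single x 1)) = s (f.rangeRestrict (Pi.single x 1)) := by
    rw [← hg]
    rfl
  have h2 : f (s (f.rangeRestrict (Pi.single x 1))) = f (Pi.single x 1) := by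
    have := LinearMap.congr_fun hs (f.rangeRestrict (Pi.single x 1))
    exact congrArg Subtype.val this
  change f (g (f (Pi.single x 1))) = f (Pi.single x 1)
  rw [h1, h2]

/-- With `Q` the submatrix on the spanning families, the row of `x` at `b` is `p Q`, the column of
`y` at `a` is `Q q`, and the entry at `(x, y)` is `p Q q`. A generalized inverse `L` of `Q` recovers
this as `(p Q) L (Q q)`, so the families need not be bases. -/
theorem exists_flipBit_eq_adjBit {V : Type u} {k m : ℕ} {G : SimpleGraph V} {a : Fin k → V}
    {b : Fin m → V} {X : Set V} (haX : ∀ i, a i ∈ X) (hbX : ∀ j, b j ∉ X) (ha : SpansCut G a X)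
    (hb : SpansCut G b Xᶜ) : ∃ L : Matrix (Fin m) (Fin k) (ZMod 2),
      ∀ x ∈ X, ∀ y ∉ X, adjBit G x y = flipBit G a b L x y := by
  let Q : Matrix (Fin k) (Fin m) (ZMod 2) := Matrix.of fun i j => adjBit G (a i) (b j)
  obtain ⟨L, hL⟩ := exists_generalized_inverse Q
  refine ⟨L, fun x hx y hy => ?_⟩
  obtain ⟨p, hp⟩ := ha x hx
  obtain ⟨q, hq⟩ := hb y hy
  have hrow : (fun j => adjBit G x (b j)) = Matrix.vecMul p Q := by
    ext j
    exact hp (b j) (hbX j)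
  have hcol : (fun i => adjBit G (a i) y) = Matrix.mulVec Q q := by
    ext i
    rw [adjBit_comm, hq (a i) (fun h => h (haX i))]
    refine Finset.sum_congr rfl fun j _ => ?_
    rw [mul_comm, adjBit_comm]
    rfl
  have hflip : flipBit G a b L x y =
      Matrix.vecMul (fun j => adjBit G x (b j)) L ⬝ᵥ (fun i => adjBit G (a i) y) := rfl
  rw [hflip, hrow, hcol, Matrix.vecMul_vecMul, Matrix.dotProduct_mulVec, Matrix.vecMul_vecMul, hL,
    ← Matrix.dotProduct_mulVec, ← hcol]
  exact hp y hy

/-! ### The flipped digraph of a cut -/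

section Arc

variable {V : Type u} {k m : ℕ} (G : SimpleGraph V) (a : Fin k → V) (b : Fin m → V)
  (L : Matrix (Fin m) (Fin k) (ZMod 2))

/-- The arcs of the flipped digraph: the pairs on which adjacency and `flipBit` disagree. -/
def FlipArc (x y : V) : Prop := adjBit G x y ≠ flipBit G a b L x y

/-- Reachability in the flipped digraph. -/
def FlipReach : V → V → Prop := Relation.ReflTransGen (FlipArc G a b L)

/-- The strong components of the flipped digraph. -/
def flipBlock (x : V) : Set V := {y | FlipReach G a b L x y ∧ FlipReach G a b L y x}

variable {G a b L}

theorem mem_flipBlock_self (x : V) : x ∈ flipBlock G a b L x :=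
  ⟨Relation.ReflTransGen.refl, Relation.ReflTransGen.refl⟩

theorem mem_flipBlock_symm {x y : V} (h : y ∈ flipBlock G a b L x) : x ∈ flipBlock G a b L y :=
  ⟨h.2, h.1⟩

theorem flipBlock_eq {x y : V} (h : y ∈ flipBlock G a b L x) :
    flipBlock G a b L y = flipBlock G a b L x := by
  ext z
  exact ⟨fun hz => ⟨h.1.trans hz.1, hz.2.trans h.2⟩, fun hz => ⟨h.2.trans hz.1, hz.2.trans h.1⟩⟩

theorem FlipReach.mem {X : Set V} (hX : ∀ x ∈ X, ∀ y ∉ X, adjBit G x y = flipBit G a b L x y)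
    {x y : V} (h : FlipReach G a b L x y) (hx : x ∈ X) : y ∈ X := by
  induction h with
  | refl => exact hx
  | tail _ harc ih =>
    by_contra hy
    exact harc (hX _ ih _ hy)

/-- The number of vertices that can be reached. -/
noncomputable def flipRank (G : SimpleGraph V) (a : Fin k → V) (b : Fin m → V)
    (L : Matrix (Fin m) (Fin k) (ZMod 2)) (x : V) : ℕ :=
  Set.ncard {y | FlipReach G a b L x y}

/-- A count of reachable vertices can be read off a stable colouring. As it drops along arcs between
different components, it reveals a direction in which there is no arc. -/
theorem flipRank_lt [Finite V] {x y : V} (h : FlipReach G a b L x y)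
    (hn : ¬ FlipReach G a b L y x) : flipRank G a b L y < flipRank G a b L x := by
  refine Set.ncard_lt_ncard ⟨fun z hz => h.trans hz, fun hsub => hn ?_⟩ (Set.toFinite _)
  exact hsub (show FlipReach G a b L x x from Relation.ReflTransGen.refl)

theorem flipRank_eq {x y : V} (h : y ∈ flipBlock G a b L x) :
    flipRank G a b L y = flipRank G a b L x := by
  unfold flipRank
  congr 1
  ext z
  exact ⟨fun hz => h.1.trans hz, fun hz => h.2.trans hz⟩

/-- Adjacency between different strong components of the flipped digraph. -/
theorem adjBit_eq_of_notMem_flipBlock [Finite V] {x y : V} (h : y ∉ flipBlock G a b L x) :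
    adjBit G x y = if flipRank G a b L x < flipRank G a b L y then flipBit G a b L x y
      else flipBit G a b L y x := by
  split_ifs with hlt
  · by_contra hne
    have hxy : FlipReach G a b L x y := Relation.ReflTransGen.single hne
    have := flipRank_lt hxy fun hyx => h ⟨hxy, hyx⟩
    omega
  · rw [adjBit_comm]
    by_contra hne
    have hyx : FlipReach G a b L y x := Relation.ReflTransGen.single hne
    exact hlt (flipRank_lt hyx fun hxy => h ⟨hxy, hyx⟩)

end Arc

/-- For a subset `X₁` of `X`, the arcs that belong to `X₁` are arcs that belong to `X`, unless they
end at an out-neighbour of one of the vertices `a₁ i`. -/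
theorem flipArc_of_flipArc_subset {V : Type u} {k m n : ℕ} {G : SimpleGraph V} {a a₁ : Fin k → V}
    {b : Fin m → V} {b₁ : Fin n → V} {L : Matrix (Fin m) (Fin k) (ZMod 2)}
    {L₁ : Matrix (Fin n) (Fin k) (ZMod 2)} {X₁ : Set V} (hb : ∀ j, b j ∉ X₁)
    (h₁ : ∀ x ∈ X₁, ∀ y ∉ X₁, adjBit G x y = flipBit G a₁ b₁ L₁ x y) {x y : V} (hx : x ∈ X₁)
    (hxy : FlipArc G a₁ b₁ L₁ x y) (ha₁ : ∀ i, ¬ FlipArc G a b L (a₁ i) y) :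
    FlipArc G a b L x y := by
  -- The row of `x` at the vertices `b j` is a combination of the rows of the `a₁ i`, with the
  -- coefficients from `h₁`. As `flipBit G a b L` depends linearly on the row of its first argument
  -- at `b`, its value at `(x, y)` is the same combination of its values at `(a₁ i, y)`; these are
  -- adjacencies since no `a₁ i` has an arc to `y`.
  have hflip : flipBit G a b L x y = flipBit G a₁ b₁ L₁ x y := by
    have hy : ∀ i, adjBit G (a₁ i) y = flipBit G a b L (a₁ i) y := fun i => not_not.mp (ha₁ i)
    have hrow : ∀ j, adjBit G x (b j) =
        ∑ i, (∑ l, adjBit G x (b₁ l) * L₁ l i) * adjBit G (a₁ i) (b j) :=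
      fun j => h₁ x hx (b j) (hb j)
    unfold flipBit
    simp only [hy]
    unfold flipBit
    simp only [hrow]
    symm
    simp only [Finset.sum_mul, Finset.mul_sum]
    rw [Finset.sum_comm]
    refine Finset.sum_congr rfl fun i _ => ?_
    rw [Finset.sum_comm]
    refine Finset.sum_congr rfl fun j _ => Finset.sum_congr rfl fun l _ => ?_
    refine Finset.sum_congr rfl fun q _ => ?_
    ring
  unfold FlipArc at hxy ⊢
  rwa [hflip]

/-! ## Stable colourings of tuples -/

/-- Colourings of the `I`-tuples of two graphs that are stable under Weisfeiler-Leman refinement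
and invariant under reindexing. -/
structure IsStablePair {I : Type*} [DecidableEq I] {V : Type u} {W : Type v} {C : Type w}
    {T : Type*} (G : SimpleGraph V) (χ : V → C) (H : SimpleGraph W) (ψ : W → C)
    (c : (I → V) → T) (d : (I → W) → T) : Prop where
  colour : ∀ {x y}, c x = d y → ∀ i, χ (x i) = ψ (y i)
  eq_iff : ∀ {x y}, c x = d y → ∀ i j, x i = x j ↔ y i = y j
  adj_iff : ∀ {x y}, c x = d y → ∀ i j, G.Adj (x i) (x j) ↔ H.Adj (y i) (y j)
  extend : ∀ {x y}, c x = d y → ∃ σ : V ≃ W, ∀ i w,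
    c (Function.update x i w) = d (Function.update y i (σ w))
  reindex : ∀ {x y}, c x = d y → ∀ f : I → I, c (x ∘ f) = d (y ∘ f)

namespace IsStablePair

section General

variable {I : Type*} [DecidableEq I] {V : Type u} {W : Type v} {C : Type w} {T : Type*}
  {G : SimpleGraph V} {χ : V → C} {H : SimpleGraph W} {ψ : W → C} {c : (I → V) → T}
  {d : (I → W) → T}

theorem symm (h : IsStablePair G χ H ψ c d) : IsStablePair H ψ G χ d c where
  colour e i := (h.colour e.symm i).symm
  eq_iff e i j := (h.eq_iff e.symm i j).symm
  adj_iff e i j := (h.adj_iff e.symm i j).symm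
  extend e := by
    obtain ⟨σ, hσ⟩ := h.extend e.symm
    refine ⟨σ.symm, fun i w => ?_⟩
    rw [hσ, σ.apply_symm_apply]
  reindex e f := (h.reindex e.symm f).symm

theorem adjBit_eq (h : IsStablePair G χ H ψ c d) {x : I → V} {y : I → W} (e : c x = d y)
    (i j : I) : adjBit G (x i) (x j) = adjBit H (y i) (y j) :=
  adjBit_eq_adjBit_iff.mpr (h.adj_iff e i j)

theorem flipBit_eq (h : IsStablePair G χ H ψ c d) {x : I → V} {y : I → W} (e : c x = d y)
    {k m : ℕ} (α : Fin k → I) (β : Fin m → I) (L : Matrix (Fin m) (Fin k) (ZMod 2)) (i j : I) :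
    flipBit G (x ∘ α) (x ∘ β) L (x i) (x j) = flipBit H (y ∘ α) (y ∘ β) L (y i) (y j) := by
  unfold flipBit
  simp only [Function.comp_apply, h.adjBit_eq e]

theorem flipArc_iff (h : IsStablePair G χ H ψ c d) {x : I → V} {y : I → W} (e : c x = d y)
    {k m : ℕ} (α : Fin k → I) (β : Fin m → I) (L : Matrix (Fin m) (Fin k) (ZMod 2)) (i j : I) :
    FlipArc G (x ∘ α) (x ∘ β) L (x i) (x j) ↔ FlipArc H (y ∘ α) (y ∘ β) L (y i) (y j) := by
  unfold FlipArc
  rw [h.adjBit_eq e, h.flipBit_eq e]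

/-- Assigned positions can be moved: any partial position that is extended by two tuples of the
same colour can be extended to further vertices. -/
theorem exists_position [Fintype I] (h : IsStablePair G χ H ψ c d) [DecidableEq V] (D : Finset V)
    (hD : D.card ≤ Fintype.card I) (D₀ : Finset V) (f₀ : V → W) (hsub : D₀ ⊆ D)
    (h₀ : ∃ x y, c x = d y ∧ ∀ z ∈ D₀, ∃ i, x i = z ∧ y i = f₀ z) :
    ∃ f : V → W, (∀ z ∈ D₀, f z = f₀ z) ∧
      ∃ x y, c x = d y ∧ ∀ z ∈ D, ∃ i, x i = z ∧ y i = f z := by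
  induction D using Finset.strongInduction with
  | H D ih =>
  by_cases hDD : D ⊆ D₀
  · exact ⟨f₀, fun _ _ => rfl, (Finset.Subset.antisymm hDD hsub) ▸ h₀⟩
  · obtain ⟨s, hsD, hs₀⟩ := Finset.not_subset.mp hDD
    obtain ⟨f, hf, x, y, hxy, hx⟩ := ih (D.erase s) (Finset.erase_ssubset hsD)
      ((Finset.card_le_card (Finset.erase_subset s D)).trans hD)
      (fun z hz => Finset.mem_erase.mpr ⟨fun hzs => hs₀ (hzs ▸ hz), hsub hz⟩)
    have : Nonempty I := Fintype.card_pos_iff.mp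
      (lt_of_lt_of_le (Finset.card_pos.mpr ⟨s, hsD⟩) hD)
    choose! p hp using hx
    -- The vertices placed so far are fewer than the positions, so some position is not needed for
    -- them and can receive `s`.
    obtain ⟨i, hi⟩ : ∃ i, i ∉ (D.erase s).image p := by
      by_contra hall
      push Not at hall
      have h1 : Fintype.card I ≤ ((D.erase s).image p).card := by
        rw [← Finset.card_univ]
        exact Finset.card_le_card fun i _ => hall i
      have h2 := (Finset.card_image_le (s := D.erase s) (f := p))
      have h3 := Finset.card_erase_lt_of_mem hsD
      omega
    obtain ⟨σ, hσ⟩ := h.extend hxy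
    refine ⟨Function.update f s (σ s), fun z hz => ?_, _, _, hσ i s, fun z hz => ?_⟩
    · rw [Function.update_of_ne (by rintro rfl; exact hs₀ hz), hf z hz]
    · by_cases hzs : z = s
      · subst hzs
        exact ⟨i, by simp, by simp⟩
      · have hz' : z ∈ D.erase s := Finset.mem_erase.mpr ⟨hzs, hz⟩
        have hne : p z ≠ i := fun hpi => hi (Finset.mem_image.mpr ⟨z, hz', hpi⟩)
        refine ⟨p z, ?_, ?_⟩
        · rw [Function.update_of_ne hne, (hp z hz').1]
        · rw [Function.update_of_ne hne, Function.update_of_ne hzs, (hp z hz').2]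

/-- A tuple can be replaced by a tuple that retains some entries and contains few vertices in
total. -/
theorem exists_tuple [Fintype I] (h : IsStablePair G χ H ψ c d) {x : I → V} {y : I → W}
    (e : c x = d y) {x' : I → V} (D : Finset V) (hD : D.card ≤ Fintype.card I)
    (hx' : ∀ i, x' i ∈ D) (J : Set I) (hJ : ∀ i ∈ J, x i ∈ D) :
    ∃ y' : I → W, c x' = d y' ∧ ∀ i, ∀ j ∈ J, x' i = x j → y' i = y j := by
  classical
  rcases isEmpty_or_nonempty I with hI | hI
  · refine ⟨y, ?_, fun i => hI.elim i⟩
    rw [← e]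
    congr 1
    exact Subsingleton.elim _ _
  obtain ⟨i₀⟩ := hI
  -- The partial position read off from `x` and `y`; it is well defined because equal colours have
  -- equal equality patterns.
  let f₀ : V → W := fun z => if hz : ∃ i, x i = z then y hz.choose else y i₀
  have hf₀ : ∀ i, f₀ (x i) = y i := fun i => by
    have hz : ∃ j, x j = x i := ⟨i, rfl⟩
    have : f₀ (x i) = y hz.choose := dif_pos hz
    rw [this]
    exact (h.eq_iff e _ _).mp hz.choose_spec
  obtain ⟨f, hf, x₁, y₁, h₁, hx₁⟩ := h.exists_position D hD
    (D.filter fun z => ∃ i ∈ J, x i = z) f₀ (Finset.filter_subset _ _) ⟨x, y, e, fun z hz => by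
      obtain ⟨-, i, -, rfl⟩ := Finset.mem_filter.mp hz
      exact ⟨i, rfl, (hf₀ i).symm⟩⟩
  choose p hp using fun i => hx₁ (x' i) (hx' i)
  refine ⟨y₁ ∘ p, ?_, fun i j hj hij => ?_⟩
  · rw [← h.reindex h₁ p]
    congr 1
    ext i
    exact (hp i).1.symm
  · have : y₁ (p i) = f (x' i) := (hp i).2
    rw [Function.comp_apply, this, hij, hf _ (Finset.mem_filter.mpr ⟨hJ j hj, j, hj, rfl⟩), hf₀]

end General

/-- The index set of the tuples: three families of `k` entries and four further entries. -/
abbrev _root_.Slot (k : ℕ) : Type := (Fin 3 × Fin k) ⊕ Fin 4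

section Slots

variable {N : ℕ} {V : Type u} {W : Type v} {C : Type w} {T : Type*}
  {G : SimpleGraph V} {χ : V → C} {H : SimpleGraph W} {ψ : W → C} {c : (Slot N → V) → T}
  {d : (Slot N → W) → T} {k m : ℕ}

/-- Induction along the path: one of the four further entries, different from both end positions, is
moved to the last vertex but one, and the stable colouring supplies a counterpart in `H`. The
spanning families are not touched by this move. -/
theorem flipReach_of_flipReach (h : IsStablePair G χ H ψ c d) (α : Fin k → Fin 3 × Fin N)
    (β : Fin m → Fin 3 × Fin N) (L : Matrix (Fin m) (Fin k) (ZMod 2)) {a : Fin k → V}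
    {b : Fin m → V} {s t : V} (hst : FlipReach G a b L s t) (x : Slot N → V) (y : Slot N → W)
    (e : c x = d y) (ha : x ∘ Sum.inl ∘ α = a) (hb : x ∘ Sum.inl ∘ β = b) (i j : Slot N)
    (hi : x i = s) (hj : x j = t) :
    FlipReach H (y ∘ Sum.inl ∘ α) (y ∘ Sum.inl ∘ β) L (y i) (y j) := by
  induction hst generalizing x y j with
  | refl =>
    rw [(h.eq_iff e i j).mp (hi.trans hj.symm)]
    exact Relation.ReflTransGen.refl
  | @tail z t _ harc ih =>
    obtain ⟨q, hqi, hqj⟩ : ∃ q : Fin 4, (Sum.inr q : Slot N) ≠ i ∧ (Sum.inr q : Slot N) ≠ j := by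
      rcases i with i | i <;> rcases j with j | j
      · exact ⟨0, by simp, by simp⟩
      · obtain ⟨q, hq⟩ := exists_ne j
        exact ⟨q, by simp, by simpa using hq⟩
      · obtain ⟨q, hq⟩ := exists_ne i
        exact ⟨q, by simpa using hq, by simp⟩
      · obtain ⟨q, hq, hq'⟩ : ∃ q : Fin 4, q ≠ i ∧ q ≠ j :=
          (by decide : ∀ i j : Fin 4, ∃ q : Fin 4, q ≠ i ∧ q ≠ j) i j
        exact ⟨q, by simpa using hq, by simpa using hq'⟩
    obtain ⟨σ, hσ⟩ := h.extend e
    have e' := hσ (Sum.inr q) z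
    have hx : ∀ {n : ℕ} (γ : Fin n → Fin 3 × Fin N),
        Function.update x (Sum.inr q) z ∘ Sum.inl ∘ γ = x ∘ Sum.inl ∘ γ := fun γ => by
      ext l
      simp
    have hy : ∀ {n : ℕ} (γ : Fin n → Fin 3 × Fin N),
        Function.update y (Sum.inr q) (σ z) ∘ Sum.inl ∘ γ = y ∘ Sum.inl ∘ γ := fun γ => by
      ext l
      simp
    have h1 := ih _ _ e' ((hx α).trans ha) ((hx β).trans hb) (Sum.inr q)
      (by rw [Function.update_of_ne hqi.symm, hi]) (by simp)
    have h2 := (h.flipArc_iff e' (Sum.inl ∘ α) (Sum.inl ∘ β) L (Sum.inr q) j).mp (by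
      rw [hx, hx, ha, hb, Function.update_of_ne hqj.symm, hj, Function.update_self]
      exact harc)
    rw [hy, hy, Function.update_of_ne hqi.symm] at h1
    rw [hy, hy, Function.update_of_ne hqj.symm] at h2
    exact h1.tail h2

theorem flipReach_iff (h : IsStablePair G χ H ψ c d) {x : Slot N → V} {y : Slot N → W}
    (e : c x = d y) (α : Fin k → Fin 3 × Fin N) (β : Fin m → Fin 3 × Fin N)
    (L : Matrix (Fin m) (Fin k) (ZMod 2)) (i j : Slot N) :
    FlipReach G (x ∘ Sum.inl ∘ α) (x ∘ Sum.inl ∘ β) L (x i) (x j) ↔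
      FlipReach H (y ∘ Sum.inl ∘ α) (y ∘ Sum.inl ∘ β) L (y i) (y j) :=
  ⟨fun hr => h.flipReach_of_flipReach α β L hr x y e rfl rfl i j rfl rfl,
    fun hr => h.symm.flipReach_of_flipReach α β L hr y x e.symm rfl rfl i j rfl rfl⟩

end Slots

end IsStablePair

/-! ### Types of vertices over a tuple -/

section VertexType

variable {N : ℕ} {V : Type u} {W : Type v} {C : Type w} {T : Type*}
  {G : SimpleGraph V} {χ : V → C} {H : SimpleGraph W} {ψ : W → C} {c : (Slot N → V) → T}
  {d : (Slot N → W) → T} {k m : ℕ}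

/-- The type of a vertex over a tuple. -/
def vertexType (c : (Slot N → V) → T) (x : Slot N → V) (s : V) : T :=
  c (Function.update x (Sum.inr 1) s)

theorem update_comp_inl {n : ℕ} (x : Slot N → V) (q : Fin 4) (s : V) (γ : Fin n → Fin 3 × Fin N) :
    Function.update x (Sum.inr q) s ∘ Sum.inl ∘ γ = x ∘ Sum.inl ∘ γ := by
  ext l
  simp

namespace IsStablePair

theorem exists_equiv_vertexType (h : IsStablePair G χ H ψ c d) {x : Slot N → V} {y : Slot N → W}
    (e : c x = d y) : ∃ σ : V ≃ W, ∀ s, vertexType c x s = vertexType d y (σ s) := by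
  obtain ⟨σ, hσ⟩ := h.extend e
  exact ⟨σ, fun s => hσ _ s⟩

/-- Vertices of the same type have the same relations to the entries of the tuples. -/
theorem of_vertexType (h : IsStablePair G χ H ψ c d) {x : Slot N → V} {y : Slot N → W} {s : V}
    {t : W} (e : vertexType c x s = vertexType d y t) :
    χ s = ψ t ∧
    (∀ i, i ≠ Sum.inr 1 → (s = x i ↔ t = y i)) ∧
    (∀ i, i ≠ Sum.inr 1 → adjBit G s (x i) = adjBit H t (y i)) ∧
    (∀ (k m : ℕ) (α : Fin k → Fin 3 × Fin N) (β : Fin m → Fin 3 × Fin N)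
      (L : Matrix (Fin m) (Fin k) (ZMod 2)), ∀ i, i ≠ Sum.inr 1 →
      (FlipReach G (x ∘ Sum.inl ∘ α) (x ∘ Sum.inl ∘ β) L (x i) s ↔
        FlipReach H (y ∘ Sum.inl ∘ α) (y ∘ Sum.inl ∘ β) L (y i) t)) ∧
    (∀ (k m : ℕ) (α : Fin k → Fin 3 × Fin N) (β : Fin m → Fin 3 × Fin N)
      (L : Matrix (Fin m) (Fin k) (ZMod 2)), ∀ i, i ≠ Sum.inr 1 →
      (flipBit G (x ∘ Sum.inl ∘ α) (x ∘ Sum.inl ∘ β) L s (x i) =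
        flipBit H (y ∘ Sum.inl ∘ α) (y ∘ Sum.inl ∘ β) L t (y i))) := by
  unfold vertexType at e
  refine ⟨by simpa using h.colour e (Sum.inr 1), fun i hi => ?_, fun i hi => ?_,
    fun k m α β L i hi => ?_, fun k m α β L i hi => ?_⟩
  · simpa [hi] using h.eq_iff e (Sum.inr 1) i
  · simpa [hi] using h.adjBit_eq e (Sum.inr 1) i
  · have := h.flipReach_iff e α β L i (Sum.inr 1)
    simpa only [update_comp_inl, Function.update_of_ne hi, Function.update_self] using this
  · have := h.flipBit_eq e (Sum.inl ∘ α) (Sum.inl ∘ β) L (Sum.inr 1) i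
    simpa only [update_comp_inl, Function.update_of_ne hi, Function.update_self] using this

/-- Vertices of the same type have the same numbers of partners for all relations that the stable
colouring knows. -/
theorem exists_equiv_of_vertexType (h : IsStablePair G χ H ψ c d) {x : Slot N → V}
    {y : Slot N → W} (hx : x (Sum.inr 2) = x (Sum.inr 0)) (hy : y (Sum.inr 2) = y (Sum.inr 0))
    {s : V} {t : W} (e : vertexType c x s = vertexType d y t) :
    ∃ σ : V ≃ W, ∀ z, vertexType c x z = vertexType d y (σ z) ∧
    (∀ (k m : ℕ) (α : Fin k → Fin 3 × Fin N) (β : Fin m → Fin 3 × Fin N)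
      (L : Matrix (Fin m) (Fin k) (ZMod 2)),
      (FlipReach G (x ∘ Sum.inl ∘ α) (x ∘ Sum.inl ∘ β) L s z ↔
        FlipReach H (y ∘ Sum.inl ∘ α) (y ∘ Sum.inl ∘ β) L t (σ z)) ∧
      (z ∈ flipBlock G (x ∘ Sum.inl ∘ α) (x ∘ Sum.inl ∘ β) L s ↔
        σ z ∈ flipBlock H (y ∘ Sum.inl ∘ α) (y ∘ Sum.inl ∘ β) L t) ∧
      (FlipArc G (x ∘ Sum.inl ∘ α) (x ∘ Sum.inl ∘ β) L s z ↔
        FlipArc H (y ∘ Sum.inl ∘ α) (y ∘ Sum.inl ∘ β) L t (σ z))) := by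
  obtain ⟨σ, hσ⟩ := h.extend e
  have h12 : (Sum.inr 1 : Slot N) ≠ Sum.inr 2 := by simp
  refine ⟨σ, fun z => ⟨?_, fun k m α β L => ?_⟩⟩
  -- The partner `z` is moved from entry `2` to entry `1`, and entry `2` is refilled with the
  -- centre. By `hx` and `hy` the result is exactly the tuple that defines the type of `z`.
  · have := h.reindex (hσ (Sum.inr 2) z) fun i =>
      if i = Sum.inr 1 then Sum.inr 2 else if i = Sum.inr 2 then Sum.inr 0 else i
    unfold vertexType
    convert this using 2
    · ext i
      by_cases h1 : i = Sum.inr 1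
      · subst h1
        simp
      · by_cases h2 : i = Sum.inr 2
        · subst h2
          simp [hx]
        · simp [h1, h2]
    · ext i
      by_cases h1 : i = Sum.inr 1
      · subst h1
        simp
      · by_cases h2 : i = Sum.inr 2
        · subst h2
          simp [hy]
        · simp [h1, h2]
  · have r1 := h.flipReach_iff (hσ (Sum.inr 2) z) α β L (Sum.inr 1) (Sum.inr 2)
    have r2 := h.flipReach_iff (hσ (Sum.inr 2) z) α β L (Sum.inr 2) (Sum.inr 1)
    have r3 := h.flipArc_iff (hσ (Sum.inr 2) z) (Sum.inl ∘ α) (Sum.inl ∘ β) L (Sum.inr 1)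
      (Sum.inr 2)
    simp only [update_comp_inl, Function.update_of_ne h12, Function.update_self] at r1 r2 r3
    exact ⟨r1, and_congr r1 r2, r3⟩

theorem flipRank_eq (h : IsStablePair G χ H ψ c d) {x : Slot N → V}
    {y : Slot N → W} (hx : x (Sum.inr 2) = x (Sum.inr 0)) (hy : y (Sum.inr 2) = y (Sum.inr 0))
    {s : V} {t : W} (e : vertexType c x s = vertexType d y t) (α : Fin k → Fin 3 × Fin N)
    (β : Fin m → Fin 3 × Fin N) (L : Matrix (Fin m) (Fin k) (ZMod 2)) :
    flipRank G (x ∘ Sum.inl ∘ α) (x ∘ Sum.inl ∘ β) L s =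
      flipRank H (y ∘ Sum.inl ∘ α) (y ∘ Sum.inl ∘ β) L t := by
  obtain ⟨σ, hσ⟩ := h.exists_equiv_of_vertexType hx hy e
  exact Set.ncard_congr (fun z _ => σ z) (fun z hz => ((hσ z).2 k m α β L).1.mp hz)
    (fun _ _ _ _ hab => σ.injective hab) fun w hw =>
      ⟨σ.symm w, ((hσ (σ.symm w)).2 k m α β L).1.mpr (by simpa using hw), by simp⟩

end IsStablePair

end VertexType

/-! ### Bijections from equal multiplicities -/

theorem exists_equiv_of_map_univ_eq {V W T : Type*} [Fintype V] [Fintype W] {f : V → T}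
    {g : W → T} (h : (Finset.univ : Finset V).val.map f = (Finset.univ : Finset W).val.map g) :
    ∃ σ : V ≃ W, ∀ x, f x = g (σ x) := by
  classical
  have hcard : ∀ t, Nonempty ({x // f x = t} ≃ {y // g y = t}) := fun t => by
    rw [← Fintype.card_eq, Fintype.card_subtype, Fintype.card_subtype]
    have := congrArg (Multiset.count t) h
    rw [Multiset.count_map, Multiset.count_map] at this
    simp only [Finset.card_def, Finset.filter_val, eq_comm (b := t)]
    exact this
  have e := fun t => (hcard t).some
  refine ⟨((Equiv.sigmaFiberEquiv f).symm.trans (Equiv.sigmaCongrRight e)).trans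
    (Equiv.sigmaFiberEquiv g), fun x => ?_⟩
  exact ((e (f x)) ⟨x, rfl⟩).2.symm

/-- A bijection between two finite sets that are unions of blocks can be assembled from bijections
between the blocks, if the vertices of every type occur equally often. -/
theorem exists_glue {V : Type u} {W : Type v} {T : Type*} [Finite V] [Finite W] (tG : V → T)
    (tH : W → T) (B : V → Set V) (B' : W → Set W) (Q : V → V → W → W → Prop) (n : ℕ) :
    ∀ (Z : Set V) (Z' : Set W), Z.ncard = n →
    (∀ x ∈ Z, x ∈ B x) → (∀ x ∈ Z, B x ⊆ Z) → (∀ x ∈ Z, ∀ y ∈ B x, B y = B x) →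
    (∀ x ∈ Z', x ∈ B' x) → (∀ x ∈ Z', B' x ⊆ Z') → (∀ x ∈ Z', ∀ y ∈ B' x, B' y = B' x) →
    (∀ t, Set.ncard {x ∈ Z | tG x = t} = Set.ncard {y ∈ Z' | tH y = t}) →
    (∀ x ∈ Z, ∀ y ∈ Z', tG x = tH y →
      ∀ t, Set.ncard {z ∈ B x | tG z = t} = Set.ncard {z ∈ B' y | tH z = t}) →
    (∀ x ∈ Z, ∀ y ∈ Z', tG x = tH y → ∃ φ : V → W, φ x = y ∧ Set.BijOn φ (B x) (B' y) ∧
      ∀ z ∈ B x, ∀ z' ∈ B x, Q z z' (φ z) (φ z')) →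
    ∀ x₀ ∈ Z, ∀ y₀ ∈ Z', tG x₀ = tH y₀ → ∃ φ : V → W, φ x₀ = y₀ ∧ Set.BijOn φ Z Z' ∧
      ∀ z ∈ Z, ∃ x ∈ Z, ∃ y ∈ Z', tG x = tH y ∧ z ∈ B x ∧ Set.BijOn φ (B x) (B' y) ∧
        ∀ z ∈ B x, ∀ z' ∈ B x, Q z z' (φ z) (φ z') := by
  classical
  induction n using Nat.strong_induction_on with
  | _ n ih =>
  intro Z Z' hn hself hsub heq hself' hsub' heq' hcount hblock hiso x₀ hx₀ y₀ hy₀ h₀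
  obtain ⟨φ, hφ, hbij, hQ⟩ := hiso x₀ hx₀ y₀ hy₀ h₀
  -- Removing one block on each side keeps the multiplicities of types equal, so the rest can be
  -- matched by induction.
  have hcount' : ∀ t, Set.ncard {x ∈ Z \ B x₀ | tG x = t} =
      Set.ncard {y ∈ Z' \ B' y₀ | tH y = t} := fun t => by
    have e1 : {x ∈ Z \ B x₀ | tG x = t} = {x ∈ Z | tG x = t} \ {x ∈ B x₀ | tG x = t} := by
      ext z
      simp only [Set.mem_ofPred_eq, Set.mem_sdiff]
      tauto
    have e2 : {x ∈ Z' \ B' y₀ | tH x = t} = {x ∈ Z' | tH x = t} \ {x ∈ B' y₀ | tH x = t} := by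
      ext z
      simp only [Set.mem_ofPred_eq, Set.mem_sdiff]
      tauto
    rw [e1, e2, Set.ncard_sdiff, Set.ncard_sdiff, hcount, hblock x₀ hx₀ y₀ hy₀ h₀]
    · exact fun z hz => ⟨hsub' y₀ hy₀ hz.1, hz.2⟩
    · exact fun z hz => ⟨hsub x₀ hx₀ hz.1, hz.2⟩
  have hsubd : ∀ x ∈ Z \ B x₀, B x ⊆ Z \ B x₀ := fun x hx z hz => by
    refine ⟨hsub x hx.1 hz, fun hz' => hx.2 ?_⟩
    rw [← heq x₀ hx₀ z hz', heq x hx.1 z hz]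
    exact hself x hx.1
  have hsubd' : ∀ x ∈ Z' \ B' y₀, B' x ⊆ Z' \ B' y₀ := fun x hx z hz => by
    refine ⟨hsub' x hx.1 hz, fun hz' => hx.2 ?_⟩
    rw [← heq' y₀ hy₀ z hz', heq' x hx.1 z hz]
    exact hself' x hx.1
  have hrest : ∃ ψ : V → W, Set.BijOn ψ (Z \ B x₀) (Z' \ B' y₀) ∧
      ∀ z ∈ Z \ B x₀, ∃ x ∈ Z \ B x₀, ∃ y ∈ Z' \ B' y₀, tG x = tH y ∧ z ∈ B x ∧
        Set.BijOn ψ (B x) (B' y) ∧ ∀ z ∈ B x, ∀ z' ∈ B x, Q z z' (ψ z) (ψ z') := by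
    have hpos : ∀ t, 0 < Set.ncard {x ∈ Z \ B x₀ | tG x = t} ↔
      ∃ x ∈ Z \ B x₀, tG x = t := fun t => Set.ncard_pos
    have hpos' : ∀ t, 0 < Set.ncard {y ∈ Z' \ B' y₀ | tH y = t} ↔
      ∃ y ∈ Z' \ B' y₀, tH y = t := fun t => Set.ncard_pos
    rcases (Z \ B x₀).eq_empty_or_nonempty with hempty | ⟨x₁, hx₁⟩
    · have hempty' : Z' \ B' y₀ = ∅ := by
        by_contra hne
        obtain ⟨y, hy⟩ := Set.nonempty_iff_ne_empty.mpr hne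
        have h1 := (hpos' (tH y)).mpr ⟨y, hy, rfl⟩
        rw [← hcount', hpos, hempty] at h1
        simp at h1
      refine ⟨φ, ?_, ?_⟩
      · rw [hempty, hempty']
        exact Set.bijOn_empty φ
      · simp [hempty]
    · obtain ⟨y₁, hy₁, h₁⟩ : ∃ y ∈ Z' \ B' y₀, tH y = tG x₁ := by
        rw [← hpos', ← hcount', hpos]
        exact ⟨x₁, hx₁, rfl⟩
      obtain ⟨ψ, -, hψ⟩ := ih (Z \ B x₀).ncard
        (by
          rw [← hn]
          exact Set.ncard_lt_ncard ⟨Set.sdiff_subset, fun h => (h hx₀).2 (hself x₀ hx₀)⟩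
            (Set.toFinite _))
        (Z \ B x₀) (Z' \ B' y₀) rfl (fun x hx => hself x hx.1) hsubd (fun x hx => heq x hx.1)
        (fun x hx => hself' x hx.1) hsubd' (fun x hx => heq' x hx.1) hcount'
        (fun x hx y hy => hblock x hx.1 y hy.1) (fun x hx y hy => hiso x hx.1 y hy.1)
        x₁ hx₁ y₁ hy₁ h₁.symm
      exact ⟨ψ, hψ⟩
  obtain ⟨ψ, hψ, hψQ⟩ := hrest
  let θ : V → W := fun z => if z ∈ B x₀ then φ z else ψ z
  have hθφ : ∀ z ∈ B x₀, θ z = φ z := fun z hz => if_pos hz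
  have hθψ : ∀ z ∈ Z \ B x₀, θ z = ψ z := fun z hz => if_neg hz.2
  have hb1 : Set.BijOn θ (B x₀) (B' y₀) := hbij.congr fun z hz => (hθφ z hz).symm
  have hb2 : Set.BijOn θ (Z \ B x₀) (Z' \ B' y₀) := hψ.congr fun z hz => (hθψ z hz).symm
  refine ⟨θ, ?_, ?_, fun z hz => ?_⟩
  · rw [hθφ x₀ (hself x₀ hx₀), hφ]
  · have := hb1.union hb2 (by
      rw [Set.injOn_union Set.disjoint_sdiff_right]
      refine ⟨hb1.injOn, hb2.injOn, fun p hp q hq hpq => ?_⟩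
      exact (hb2.mapsTo hq).2 (hpq ▸ hb1.mapsTo hp))
    rwa [Set.union_sdiff_cancel (hsub x₀ hx₀), Set.union_sdiff_cancel (hsub' y₀ hy₀)] at this
  · by_cases hzB : z ∈ B x₀
    · refine ⟨x₀, hx₀, y₀, hy₀, h₀, hzB, hb1, fun p hp q hq => ?_⟩
      rw [hθφ p hp, hθφ q hq]
      exact hQ p hp q hq
    · obtain ⟨x, hx, y, hy, hxy, hzx, hbx, hQx⟩ := hψQ z ⟨hz, hzB⟩
      have hx' := hsubd x hx
      refine ⟨x, hx.1, y, hy.1, hxy, hzx, hbx.congr fun p hp => (hθψ p (hx' hp)).symm,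
        fun p hp q hq => ?_⟩
      rw [hθψ p (hx' hp), hθψ q (hx' hq)]
      exact hQx p hp q hq

/-! ## Cuts that are given by the entries of a tuple -/

/-- Slots for the two spanning families of a cut, together with a coefficient matrix. -/
structure SlotCut (N : ℕ) where
  /-- The number of columns. -/
  m : ℕ
  /-- The slots of the row vertices. -/
  α : Fin N → Fin 3 × Fin N
  /-- The slots of the column vertices. -/
  β : Fin m → Fin 3 × Fin N
  /-- The coefficient matrix. -/
  L : Matrix (Fin m) (Fin N) (ZMod 2)

namespace SlotCut

variable {N : ℕ} {V : Type u} {W : Type v} {C : Type w} {T : Type*}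

/-- The row vertices. -/
abbrev row (D : SlotCut N) (x : Slot N → V) : Fin N → V := x ∘ Sum.inl ∘ D.α

/-- The column vertices. -/
abbrev col (D : SlotCut N) (x : Slot N → V) : Fin D.m → V := x ∘ Sum.inl ∘ D.β

/-- The bilinear expression of the cut. -/
noncomputable abbrev bit (D : SlotCut N) (G : SimpleGraph V) (x : Slot N → V) : V → V → ZMod 2 :=
  flipBit G (D.row x) (D.col x) D.L

/-- The arcs of the flipped digraph of the cut. -/
abbrev Arc (D : SlotCut N) (G : SimpleGraph V) (x : Slot N → V) : V → V → Prop :=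
  FlipArc G (D.row x) (D.col x) D.L

/-- Reachability in the flipped digraph of the cut. -/
abbrev Reach (D : SlotCut N) (G : SimpleGraph V) (x : Slot N → V) : V → V → Prop :=
  FlipReach G (D.row x) (D.col x) D.L

/-- The strong components of the flipped digraph of the cut. -/
abbrev block (D : SlotCut N) (G : SimpleGraph V) (x : Slot N → V) : V → Set V :=
  flipBlock G (D.row x) (D.col x) D.L

/-- The bilinear expression of the cut describes the edges that leave `X`. -/
def Separates (D : SlotCut N) (G : SimpleGraph V) (x : Slot N → V) (X : Set V) : Prop :=
  ∀ s ∈ X, ∀ t ∉ X, adjBit G s t = D.bit G x s t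

/-- The strong component of `s` is mapped isomorphically to that of `t`. -/
def IsoAt (D : SlotCut N) (G : SimpleGraph V) (χ : V → C) (H : SimpleGraph W) (ψ : W → C)
    (x : Slot N → V) (y : Slot N → W) (s : V) (t : W) : Prop :=
  ∃ φ : V → W, φ s = t ∧ Set.BijOn φ (D.block G x s) (D.block H y t) ∧
    ∀ z ∈ D.block G x s, χ z = ψ (φ z) ∧
      (∀ i, adjBit G z (D.row x i) = adjBit H (φ z) (D.row y i)) ∧
      (∀ j, adjBit G z (D.col x j) = adjBit H (φ z) (D.col y j)) ∧
      ∀ w ∈ D.block G x s, adjBit G z w = adjBit H (φ z) (φ w)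

/-- The induction hypothesis covers only vertices of the node's set. A vertex `s` that merely shares
its type with such an `s₀` is treated by going back from `s` to `s₀` inside `G` and then on to `H`.
-/
theorem IsoAt.trans_symm {D : SlotCut N} {G : SimpleGraph V} {χ : V → C} {H : SimpleGraph W}
    {ψ : W → C} {x : Slot N → V} {y : Slot N → W} {s₀ s : V} {t : W}
    (h : D.IsoAt G χ G χ x x s₀ s) (h' : D.IsoAt G χ H ψ x y s₀ t) :
    D.IsoAt G χ H ψ x y s t := by
  obtain ⟨φ, hφ, hb, hp⟩ := h
  obtain ⟨φ', hφ', hb', hp'⟩ := h'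
  have : Nonempty V := ⟨s⟩
  have hinv : Set.InvOn (Function.invFunOn φ (D.block G x s₀)) φ (D.block G x s₀)
    (D.block G x s) := hb.invOn_invFunOn
  have hbinv : Set.BijOn (Function.invFunOn φ (D.block G x s₀)) (D.block G x s)
    (D.block G x s₀) := Set.BijOn.symm hinv.symm hb
  refine ⟨φ' ∘ Function.invFunOn φ (D.block G x s₀), ?_, hb'.comp hbinv, fun z hz => ?_⟩
  · rw [← hφ, Function.comp_apply, hinv.1 (mem_flipBlock_self s₀), hφ']
  · have key : ∀ z ∈ D.block G x s, ∃ z₀ ∈ D.block G x s₀, φ z₀ = z ∧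
        (φ' ∘ Function.invFunOn φ (D.block G x s₀)) z = φ' z₀ :=
      fun z hz => ⟨_, hbinv.mapsTo hz, hinv.2 hz, rfl⟩
    obtain ⟨z₀, hz₀, rfl, hz'⟩ := key z hz
    obtain ⟨p1, p2, p3, p4⟩ := hp z₀ hz₀
    obtain ⟨q1, q2, q3, q4⟩ := hp' z₀ hz₀
    refine ⟨?_, fun i => ?_, fun j => ?_, fun w hw => ?_⟩
    · rw [hz', ← p1, q1]
    · rw [hz', ← p2, q2]
    · rw [hz', ← p3, q3]
    · obtain ⟨w₀, hw₀, rfl, hw'⟩ := key w hw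
      rw [hz', hw', ← p4 w₀ hw₀, q4 w₀ hw₀]

/-- The bilinear expression sees its arguments only through their adjacency to the spanning
families. It is therefore preserved even for pairs taken from different components. -/
theorem bit_eq_bit {D : SlotCut N} {G : SimpleGraph V} {H : SimpleGraph W} {x : Slot N → V}
    {y : Slot N → W} {s t : V} {s' t' : W}
    (hs : ∀ j, adjBit G s (D.col x j) = adjBit H s' (D.col y j))
    (ht : ∀ i, adjBit G t (D.row x i) = adjBit H t' (D.row y i)) :
    D.bit G x s t = D.bit H y s' t' := by
  unfold bit flipBit
  simp only [hs, adjBit_comm G _ t, adjBit_comm H _ t', ht]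

/-- A bijection that preserves arcs between two closed sets preserves strong components. -/
theorem bijOn_block {D : SlotCut N} {G : SimpleGraph V} {H : SimpleGraph W} {x : Slot N → V}
    {y : Slot N → W} {Z : Set V} {Z' : Set W} {φ : V → W} (hφ : Set.BijOn φ Z Z')
    (hZ : ∀ s ∈ Z, ∀ t, D.Reach G x s t → t ∈ Z)
    (hZ' : ∀ s ∈ Z', ∀ t, D.Reach H y s t → t ∈ Z')
    (harc : ∀ s ∈ Z, ∀ t ∈ Z, D.Arc G x s t ↔ D.Arc H y (φ s) (φ t)) {s : V} (hs : s ∈ Z) :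
    Set.BijOn φ (D.block G x s) (D.block H y (φ s)) := by
  have h1 : ∀ s ∈ Z, ∀ t, D.Reach G x s t → D.Reach H y (φ s) (φ t) := fun s hs t ht => by
    induction ht with
    | refl => exact Relation.ReflTransGen.refl
    | tail hr ha ih =>
      exact ih.tail ((harc _ (hZ s hs _ hr) _ (hZ s hs _ (hr.tail ha))).mp ha)
  have h2 : ∀ s ∈ Z, ∀ t, D.Reach H y (φ s) t → ∃ t₀ ∈ Z, φ t₀ = t ∧ D.Reach G x s t₀ :=
    fun s hs t ht => by
    induction ht with
    | refl => exact ⟨s, hs, rfl, Relation.ReflTransGen.refl⟩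
    | tail hr ha ih =>
      obtain ⟨t₀, ht₀, rfl, hst⟩ := ih
      obtain ⟨w₀, hw₀, rfl⟩ := hφ.surjOn (hZ' _ (hφ.mapsTo hs) _ (hr.tail ha))
      exact ⟨w₀, hw₀, rfl, hst.tail ((harc _ ht₀ _ hw₀).mpr ha)⟩
  refine ⟨fun t ht => ⟨h1 s hs t ht.1, h1 t (hZ s hs t ht.1) s ht.2⟩,
    hφ.injOn.mono fun t ht => hZ s hs t ht.1, fun t ht => ?_⟩
  obtain ⟨t₀, ht₀, rfl, hst⟩ := h2 s hs t ht.1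
  refine ⟨t₀, ⟨hst, ?_⟩, rfl⟩
  obtain ⟨s₀, hs₀, hss, hr⟩ := h2 t₀ ht₀ _ ht.2
  rwa [hφ.injOn hs₀ hs hss] at hr

variable {G : SimpleGraph V} {χ : V → C} {H : SimpleGraph W} {ψ : W → C} {c : (Slot N → V) → T}
  {d : (Slot N → W) → T}

/-- Outside the set of a cut, adjacency to a vertex that looks like a vertex of the set is given by
the bilinear expression. -/
theorem Separates.adjBit_slot {D : SlotCut N} {x : Slot N → V} {X : Set V}
    (hD : D.Separates G x X) (h : IsStablePair G χ H ψ c d) {y : Slot N → W} {s : V} (hs : s ∈ X)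
    {t : W} (e : vertexType c x s = vertexType d y t) {i : Fin 3 × Fin N}
    (hi : x (Sum.inl i) ∉ X) : adjBit H t (y (Sum.inl i)) = D.bit H y t (y (Sum.inl i)) := by
  obtain ⟨-, -, h1, -, h2⟩ := h.of_vertexType e
  rw [← h1 _ (by simp), hD s hs _ hi]
  exact h2 _ _ D.α D.β D.L _ (by simp)

/-- Isomorphisms between strong components also preserve adjacency to the entries outside the set
of the cut. -/
theorem Separates.adjBit_slot_eq {D : SlotCut N} {x : Slot N → V} {X : Set V}
    (hD : D.Separates G x X) (hG : IsStablePair G χ G χ c c) (h : IsStablePair G χ H ψ c d)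
    {y : Slot N → W} (e : c x = d y) {z : V} {z' : W}
    {s : V} (hs : s ∈ X) (es : vertexType c x s = vertexType c x z)
    {s' : V} (hs' : s' ∈ X) (es' : vertexType c x s' = vertexType d y z')
    (hz : ∀ j, adjBit G z (D.col x j) = adjBit H z' (D.col y j)) {i : Fin 3 × Fin N}
    (hi : x (Sum.inl i) ∉ X) :
    adjBit G z (x (Sum.inl i)) = adjBit H z' (y (Sum.inl i)) := by
  rw [hD.adjBit_slot hG hs es hi, hD.adjBit_slot h hs' es' hi]
  exact bit_eq_bit hz fun _ => h.adjBit_eq e _ _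

end SlotCut

/-! ### The cuts of a node and of its two children -/

/-- Cuts for two disjoint sets and for their union, whose spanning families belong to a common
tuple of few vertices. -/
structure NiceCuts {N : ℕ} {V : Type u} (G : SimpleGraph V) (x : Slot N → V) (X₁ X₂ : Set V)
    (D D₁ D₂ : SlotCut N) : Prop where
  disj : Disjoint X₁ X₂
  sep : D.Separates G x (X₁ ∪ X₂)
  sep₁ : D₁.Separates G x X₁
  sep₂ : D₂.Separates G x X₂
  row_mem₁ : ∀ i, D₁.row x i ∈ X₁
  row_mem₂ : ∀ i, D₂.row x i ∈ X₂
  col_notMem : ∀ j, D.col x j ∉ X₁ ∪ X₂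
  row_slot : Set.range D.α ⊆ Set.range D₁.α ∪ Set.range D₂.α
  col_slot₁ : Set.range D₁.β ⊆ Set.range D₂.α ∪ Set.range D.β
  col_slot₂ : Set.range D₂.β ⊆ Set.range D₁.α ∪ Set.range D.β
  centre_mem : x (Sum.inr 0) ∈ X₁ ∪ X₂
  spare : x (Sum.inr 2) = x (Sum.inr 0)

/-- The vertices that can be reached from the root vertices of two cuts and from the entry `0`. -/
def SlotCut.reachSet {N : ℕ} {V : Type u} (D D₁ D₂ : SlotCut N) (G : SimpleGraph V)
    (x : Slot N → V) : Set V :=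
  {z | D.Reach G x (x (Sum.inr 0)) z ∨ (∃ i, D.Reach G x (D₁.row x i) z) ∨
    ∃ i, D.Reach G x (D₂.row x i) z}

open Classical in
/-- Strong components for the first or for the second cut, depending on the type of the vertex. -/
noncomputable def SlotCut.mixedBlock {N : ℕ} {V : Type u} {T : Type*} (D₁ D₂ : SlotCut N)
    (G : SimpleGraph V) (c : (Slot N → V) → T) (x : Slot N → V) (S : Set T) (s : V) : Set V :=
  if vertexType c x s ∈ S then D₁.block G x s else D₂.block G x s

namespace NiceCuts

variable {N : ℕ} {V : Type u} {W : Type v} {C : Type w} {T : Type*}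
variable {G : SimpleGraph V} {χ : V → C} {H : SimpleGraph W} {ψ : W → C} {c : (Slot N → V) → T}
  {d : (Slot N → W) → T} {x : Slot N → V} {y : Slot N → W} {X₁ X₂ : Set V}
  {D D₁ D₂ : SlotCut N}

theorem reachSet_subset (n : NiceCuts G x X₁ X₂ D D₁ D₂) :
    SlotCut.reachSet D D₁ D₂ G x ⊆ X₁ ∪ X₂ := by
  rintro z (h | ⟨i, h⟩ | ⟨i, h⟩)
  · exact FlipReach.mem n.sep h n.centre_mem
  · exact FlipReach.mem n.sep h (Or.inl (n.row_mem₁ i))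
  · exact FlipReach.mem n.sep h (Or.inr (n.row_mem₂ i))

theorem _root_.SlotCut.reachSet_closed {s t : V} (hs : s ∈ SlotCut.reachSet D D₁ D₂ G x)
    (h : D.Reach G x s t) : t ∈ SlotCut.reachSet D D₁ D₂ G x := by
  rcases hs with hs | ⟨i, hs⟩ | ⟨i, hs⟩
  · exact Or.inl (hs.trans h)
  · exact Or.inr (Or.inl ⟨i, hs.trans h⟩)
  · exact Or.inr (Or.inr ⟨i, hs.trans h⟩)

/-- All starting vertices are entries of the tuple other than entry `1`, so a type records whether
its vertex is reachable from them. -/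
theorem _root_.SlotCut.mem_reachSet_iff (h : IsStablePair G χ H ψ c d) {s : V} {t : W}
    (e : vertexType c x s = vertexType d y t) :
    s ∈ SlotCut.reachSet D D₁ D₂ G x ↔ t ∈ SlotCut.reachSet D D₁ D₂ H y := by
  obtain ⟨-, -, -, hr, -⟩ := h.of_vertexType e
  exact or_congr (hr _ _ D.α D.β D.L _ (by simp))
    (or_congr (exists_congr fun i => hr _ _ D.α D.β D.L (Sum.inl (D₁.α i)) (by simp))
      (exists_congr fun i => hr _ _ D.α D.β D.L (Sum.inl (D₂.α i)) (by simp)))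

/-- By `flipArc_of_flipArc_subset`, an arc of the child that is no arc of the parent ends at an
out-neighbour of a row vertex of the child. This is why the row vertices of both children are among
the starting vertices of the reachable set. -/
theorem reach₁ (n : NiceCuts G x X₁ X₂ D D₁ D₂) {s t : V}
    (hs : s ∈ SlotCut.reachSet D D₁ D₂ G x) (hs₁ : s ∈ X₁) (h : D₁.Reach G x s t) :
    t ∈ SlotCut.reachSet D D₁ D₂ G x := by
  induction h with
  | refl => exact hs
  | @tail t w hr ha ih =>
    by_contra hw
    refine hw (SlotCut.reachSet_closed ih (Relation.ReflTransGen.single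
      (flipArc_of_flipArc_subset (fun j hj => n.col_notMem j (Or.inl hj)) n.sep₁
        (FlipReach.mem n.sep₁ hr hs₁) ha fun i hi => hw ?_)))
    exact Or.inr (Or.inl ⟨i, Relation.ReflTransGen.single hi⟩)

theorem reach₂ (n : NiceCuts G x X₁ X₂ D D₁ D₂) {s t : V}
    (hs : s ∈ SlotCut.reachSet D D₁ D₂ G x) (hs₂ : s ∈ X₂) (h : D₂.Reach G x s t) :
    t ∈ SlotCut.reachSet D D₁ D₂ G x := by
  induction h with
  | refl => exact hs
  | @tail t w hr ha ih =>
    by_contra hw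
    refine hw (SlotCut.reachSet_closed ih (Relation.ReflTransGen.single
      (flipArc_of_flipArc_subset (fun j hj => n.col_notMem j (Or.inr hj)) n.sep₂
        (FlipReach.mem n.sep₂ hr hs₂) ha fun i hi => hw ?_)))
    exact Or.inr (Or.inr ⟨i, Relation.ReflTransGen.single hi⟩)

/-- The types of the vertices of `X`. -/
abbrev _root_.typesIn (c : (Slot N → V) → T) (x : Slot N → V) (X : Set V) : Set T :=
  vertexType c x '' X

theorem mem_of_notMem_typesIn (n : NiceCuts G x X₁ X₂ D D₁ D₂) {s : V}
    (hs : s ∈ SlotCut.reachSet D D₁ D₂ G x) (h : vertexType c x s ∉ typesIn c x X₁) : s ∈ X₂ :=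
  (n.reachSet_subset hs).resolve_left fun hs₁ => h ⟨s, hs₁, rfl⟩

/-- The vertex `s` need not lie in `X₁`. The statement holds for a vertex of `X₁` of the same type,
and the bijection between partners carries it over. -/
theorem block₁ (n : NiceCuts G x X₁ X₂ D D₁ D₂) (hG : IsStablePair G χ G χ c c) {s t : V}
    (hs : s ∈ SlotCut.reachSet D D₁ D₂ G x) (h : vertexType c x s ∈ typesIn c x X₁)
    (ht : t ∈ D₁.block G x s) :
    t ∈ SlotCut.reachSet D D₁ D₂ G x ∧ vertexType c x t ∈ typesIn c x X₁ := by
  obtain ⟨s₀, hs₀, e⟩ := h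
  obtain ⟨σ, hσ⟩ := hG.exists_equiv_of_vertexType n.spare n.spare e
  obtain ⟨t₀, rfl⟩ := σ.surjective t
  have hr : D₁.Reach G x s₀ t₀ := (((hσ t₀).2 _ _ D₁.α D₁.β D₁.L).2.1.mpr ht).1
  have hs₀Z : s₀ ∈ SlotCut.reachSet D D₁ D₂ G x := (SlotCut.mem_reachSet_iff hG e).mpr hs
  exact ⟨(SlotCut.mem_reachSet_iff hG (hσ t₀).1).mp (n.reach₁ hs₀Z hs₀ hr),
    t₀, FlipReach.mem n.sep₁ hr hs₀, (hσ t₀).1⟩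

/-- If `t` had the type of some `t₀` in `X₁`, then a counterpart of `s` would lie in `X₂` and reach
`t₀` in the digraph of `D₂`, although no arc of this digraph leaves `X₂`. -/
theorem block₂ (n : NiceCuts G x X₁ X₂ D D₁ D₂) (hG : IsStablePair G χ G χ c c) {s t : V}
    (hs : s ∈ SlotCut.reachSet D D₁ D₂ G x) (h : vertexType c x s ∉ typesIn c x X₁)
    (ht : t ∈ D₂.block G x s) :
    t ∈ SlotCut.reachSet D D₁ D₂ G x ∧ vertexType c x t ∉ typesIn c x X₁ := by
  refine ⟨n.reach₂ hs (n.mem_of_notMem_typesIn hs h) ht.1, ?_⟩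
  rintro ⟨t₀, ht₀, e⟩
  obtain ⟨σ, hσ⟩ := hG.exists_equiv_of_vertexType n.spare n.spare e
  obtain ⟨s₀, hs₀⟩ := σ.surjective s
  have hb : s₀ ∈ D₂.block G x t₀ :=
    ((hσ s₀).2 _ _ D₂.α D₂.β D₂.L).2.1.mpr (hs₀.symm ▸ mem_flipBlock_symm ht)
  have hss : vertexType c x s₀ = vertexType c x s := hs₀ ▸ (hσ s₀).1
  have hs₀Z : s₀ ∈ SlotCut.reachSet D D₁ D₂ G x := (SlotCut.mem_reachSet_iff hG hss).mpr hs
  have hs₀₂ : s₀ ∈ X₂ := n.mem_of_notMem_typesIn hs₀Z (hss ▸ h)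
  exact Set.disjoint_left.mp n.disj ht₀ (FlipReach.mem n.sep₂ hb.2 hs₀₂)

theorem mem_mixedBlock (n : NiceCuts G x X₁ X₂ D D₁ D₂) (hG : IsStablePair G χ G χ c c) {s t : V}
    (hs : s ∈ SlotCut.reachSet D D₁ D₂ G x)
    (ht : t ∈ SlotCut.mixedBlock D₁ D₂ G c x (typesIn c x X₁) s) :
    t ∈ SlotCut.reachSet D D₁ D₂ G x ∧
      (vertexType c x t ∈ typesIn c x X₁ ↔ vertexType c x s ∈ typesIn c x X₁) := by
  unfold SlotCut.mixedBlock at ht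
  split_ifs at ht with h
  · have := n.block₁ hG hs h ht
    tauto
  · have := n.block₂ hG hs h ht
    tauto

theorem _root_.SlotCut.mem_mixedBlock_self (S : Set T) (s : V) :
    s ∈ SlotCut.mixedBlock D₁ D₂ G c x S s := by
  unfold SlotCut.mixedBlock
  split_ifs
  · exact mem_flipBlock_self s
  · exact mem_flipBlock_self s

theorem _root_.SlotCut.mixedBlock_eq {S : Set T} {s t : V}
    (h : vertexType c x t ∈ S ↔ vertexType c x s ∈ S)
    (ht : t ∈ SlotCut.mixedBlock D₁ D₂ G c x S s) :
    SlotCut.mixedBlock D₁ D₂ G c x S t = SlotCut.mixedBlock D₁ D₂ G c x S s := by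
  unfold SlotCut.mixedBlock at ht ⊢
  by_cases hs : vertexType c x s ∈ S
  · rw [if_pos hs] at ht ⊢
    rw [if_pos (h.mpr hs)]
    exact flipBlock_eq ht
  · rw [if_neg hs] at ht ⊢
    rw [if_neg (h.not.mpr hs)]
    exact flipBlock_eq ht

theorem _root_.SlotCut.exists_equiv_mixedBlock (h : IsStablePair G χ H ψ c d)
    (hx : x (Sum.inr 2) = x (Sum.inr 0)) (hy : y (Sum.inr 2) = y (Sum.inr 0)) (S : Set T) {s : V}
    {t : W} (e : vertexType c x s = vertexType d y t) :
    ∃ σ : V ≃ W, ∀ z, vertexType c x z = vertexType d y (σ z) ∧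
      (z ∈ SlotCut.mixedBlock D₁ D₂ G c x S s ↔ σ z ∈ SlotCut.mixedBlock D₁ D₂ H d y S t) := by
  obtain ⟨σ, hσ⟩ := h.exists_equiv_of_vertexType hx hy e
  refine ⟨σ, fun z => ⟨(hσ z).1, ?_⟩⟩
  unfold SlotCut.mixedBlock
  rw [e]
  split_ifs
  · exact ((hσ z).2 _ _ D₁.α D₁.β D₁.L).2.1
  · exact ((hσ z).2 _ _ D₂.α D₂.β D₂.L).2.1

/-- There is no counterpart of `X₁` and `X₂` in `H`. The set of types of the vertices of `X₁` takes
their place, and the property is pulled back to `G` along bijections that respect types. -/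
theorem mem_mixedBlock_right (n : NiceCuts G x X₁ X₂ D D₁ D₂) (hG : IsStablePair G χ G χ c c)
    (h : IsStablePair G χ H ψ c d) (e : c x = d y) {s t : W}
    (hs : s ∈ SlotCut.reachSet D D₁ D₂ H y)
    (ht : t ∈ SlotCut.mixedBlock D₁ D₂ H d y (typesIn c x X₁) s) :
    t ∈ SlotCut.reachSet D D₁ D₂ H y ∧
      (vertexType d y t ∈ typesIn c x X₁ ↔ vertexType d y s ∈ typesIn c x X₁) := by
  obtain ⟨τ, hτ⟩ := h.exists_equiv_vertexType e
  obtain ⟨s₀, rfl⟩ := τ.surjective s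
  obtain ⟨σ, hσ⟩ := SlotCut.exists_equiv_mixedBlock (D₁ := D₁) (D₂ := D₂) h n.spare
    ((h.eq_iff e _ _).mp n.spare) (typesIn c x X₁) (hτ s₀)
  obtain ⟨t₀, rfl⟩ := σ.surjective t
  have h1 := n.mem_mixedBlock hG ((SlotCut.mem_reachSet_iff h (hτ s₀)).mpr hs)
    ((hσ t₀).2.mpr ht)
  rw [← hτ s₀, ← (hσ t₀).1]
  exact ⟨(SlotCut.mem_reachSet_iff h (hσ t₀).1).mp h1.1, h1.2⟩

/-- There are no arcs for the first cut from vertices of the first kind to vertices of the second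
kind. -/
theorem not_arc (n : NiceCuts G x X₁ X₂ D D₁ D₂) (h : IsStablePair G χ H ψ c d)
    (e : c x = d y) {s t : W} (ht : t ∈ SlotCut.reachSet D D₁ D₂ H y)
    (hs₁ : vertexType d y s ∈ typesIn c x X₁) (ht₁ : vertexType d y t ∉ typesIn c x X₁) :
    ¬ D₁.Arc H y s t := by
  obtain ⟨s₀, hs₀, hss⟩ := hs₁
  obtain ⟨σ, hσ⟩ := h.exists_equiv_of_vertexType n.spare ((h.eq_iff e _ _).mp n.spare) hss
  obtain ⟨t₀, rfl⟩ := σ.surjective t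
  rw [← (hσ t₀).1] at ht₁
  have h₂ := n.mem_of_notMem_typesIn ((SlotCut.mem_reachSet_iff h (hσ t₀).1).mpr ht) ht₁
  intro harc
  exact ((hσ t₀).2 _ _ D₁.α D₁.β D₁.L).2.2.mpr harc
    (n.sep₁ s₀ hs₀ t₀ fun h₁ => Set.disjoint_left.mp n.disj h₁ h₂)

/-- The slots of all the spanning families. -/
abbrev _root_.SlotCut.slots (D D₁ D₂ : SlotCut N) : Set (Fin 3 × Fin N) :=
  Set.range D₁.α ∪ Set.range D₂.α ∪ Set.range D.β

theorem row₁_mem_slots (i : Fin N) : D₁.α i ∈ SlotCut.slots D D₁ D₂ := Or.inl (Or.inl ⟨i, rfl⟩)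

theorem row₂_mem_slots (i : Fin N) : D₂.α i ∈ SlotCut.slots D D₁ D₂ := Or.inl (Or.inr ⟨i, rfl⟩)

theorem col_mem_slots (j : Fin D.m) : D.β j ∈ SlotCut.slots D D₁ D₂ := Or.inr ⟨j, rfl⟩

theorem row_mem_slots (n : NiceCuts G x X₁ X₂ D D₁ D₂) (i : Fin N) :
    D.α i ∈ SlotCut.slots D D₁ D₂ := Or.inl (n.row_slot ⟨i, rfl⟩)

theorem col₁_mem_slots (n : NiceCuts G x X₁ X₂ D D₁ D₂) (j : Fin D₁.m) :
    D₁.β j ∈ SlotCut.slots D D₁ D₂ := by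
  rcases n.col_slot₁ ⟨j, rfl⟩ with h | h
  · exact Or.inl (Or.inr h)
  · exact Or.inr h

theorem col₂_mem_slots (n : NiceCuts G x X₁ X₂ D D₁ D₂) (j : Fin D₂.m) :
    D₂.β j ∈ SlotCut.slots D D₁ D₂ := by
  rcases n.col_slot₂ ⟨j, rfl⟩ with h | h
  · exact Or.inl (Or.inl h)
  · exact Or.inr h

theorem slot_cases₁ (n : NiceCuts G x X₁ X₂ D D₁ D₂) {i : Fin 3 × Fin N}
    (hi : i ∈ SlotCut.slots D D₁ D₂) : (∃ j, D₁.α j = i) ∨ x (Sum.inl i) ∉ X₁ := by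
  rcases hi with (⟨j, rfl⟩ | ⟨j, rfl⟩) | ⟨j, rfl⟩
  · exact Or.inl ⟨j, rfl⟩
  · exact Or.inr fun h => Set.disjoint_left.mp n.disj h (n.row_mem₂ j)
  · exact Or.inr fun h => n.col_notMem j (Or.inl h)

theorem slot_cases₂ (n : NiceCuts G x X₁ X₂ D D₁ D₂) {i : Fin 3 × Fin N}
    (hi : i ∈ SlotCut.slots D D₁ D₂) : (∃ j, D₂.α j = i) ∨ x (Sum.inl i) ∉ X₂ := by
  rcases hi with (⟨j, rfl⟩ | ⟨j, rfl⟩) | ⟨j, rfl⟩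
  · exact Or.inr fun h => Set.disjoint_left.mp n.disj (n.row_mem₁ j) h
  · exact Or.inl ⟨j, rfl⟩
  · exact Or.inr fun h => n.col_notMem j (Or.inr h)

end NiceCuts

/-- What an isomorphism has to preserve: colours, adjacency, and adjacency to the entries in the
slots `S`. -/
def PreservesPair {N : ℕ} {V : Type u} {W : Type v} {C : Type w} (G : SimpleGraph V) (χ : V → C)
    (H : SimpleGraph W) (ψ : W → C) (x : Slot N → V) (y : Slot N → W) (S : Set (Fin 3 × Fin N))
    (s t : V) (s' t' : W) : Prop :=
  χ s = ψ s' ∧ (∀ i ∈ S, adjBit G s (x (Sum.inl i)) = adjBit H s' (y (Sum.inl i))) ∧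
    adjBit G s t = adjBit H s' t'

/-- Adjacency between different strong components is preserved. -/
theorem SlotCut.adjBit_eq_of_notMem_block {N : ℕ} {V : Type u} {W : Type v} {C : Type w}
    {T : Type*} [Finite V] [Finite W] {G : SimpleGraph V} {χ : V → C} {H : SimpleGraph W}
    {ψ : W → C} {c : (Slot N → V) → T} {d : (Slot N → W) → T} {x : Slot N → V} {y : Slot N → W}
    {D : SlotCut N} (h : IsStablePair G χ H ψ c d) (hx : x (Sum.inr 2) = x (Sum.inr 0))
    (hy : y (Sum.inr 2) = y (Sum.inr 0)) {s₀ s t₀ t : V} {s₀' s' t₀' t' : W}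
    (hs : vertexType c x s₀ = vertexType d y s₀') (hss : s ∈ D.block G x s₀)
    (hss' : s' ∈ D.block H y s₀') (ht : vertexType c x t₀ = vertexType d y t₀')
    (htt : t ∈ D.block G x t₀) (htt' : t' ∈ D.block H y t₀') (hst : t ∉ D.block G x s)
    (hst' : t' ∉ D.block H y s')
    (hbit : D.bit G x s t = D.bit H y s' t') (hbit' : D.bit G x t s = D.bit H y t' s') :
    adjBit G s t = adjBit H s' t' := by
  -- The vertices `s` and `s'` need not have the same type, only the representatives `s₀` and `s₀'`
  -- of their components do. This suffices because the rank is constant on components.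
  rw [adjBit_eq_of_notMem_flipBlock hst, adjBit_eq_of_notMem_flipBlock hst',
    flipRank_eq hss, flipRank_eq hss', flipRank_eq htt, flipRank_eq htt',
    h.flipRank_eq hx hy hs D.α D.β D.L, h.flipRank_eq hx hy ht D.α D.β D.L]
  split_ifs
  · exact hbit
  · exact hbit'

theorem IsStablePair.vertexType_entry {N : ℕ} {V : Type u} {W : Type v} {C : Type w} {T : Type*}
    {G : SimpleGraph V} {χ : V → C} {H : SimpleGraph W} {ψ : W → C} {c : (Slot N → V) → T}
    {d : (Slot N → W) → T} (h : IsStablePair G χ H ψ c d) {x : Slot N → V} {y : Slot N → W}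
    (e : c x = d y) (i : Slot N) : vertexType c x (x i) = vertexType d y (y i) := by
  have := h.reindex e (Function.update id (Sum.inr 1) i)
  simpa [vertexType, Function.comp_update] using this

theorem ncard_eq_of_equiv {V : Type u} {W : Type v} (σ : V ≃ W) {A : Set V} {B : Set W}
    (h : ∀ z, z ∈ A ↔ σ z ∈ B) : A.ncard = B.ncard :=
  Set.ncard_congr (fun z _ => σ z) (fun z hz => (h z).mp hz) (fun _ _ _ _ hab => σ.injective hab)
    fun w hw => ⟨σ.symm w, (h _).mpr (by simpa using hw), by simp⟩

/-! ### Assembling isomorphisms of the children's components -/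

namespace NiceCuts

variable {N : ℕ} {V : Type u} {W : Type v} {C : Type w} {T : Type*}
variable {G : SimpleGraph V} {χ : V → C} {H : SimpleGraph W} {ψ : W → C} {c : (Slot N → V) → T}
  {d : (Slot N → W) → T} {x : Slot N → V} {y : Slot N → W} {X₁ X₂ : Set V}
  {D D₁ D₂ : SlotCut N}

/-- Isomorphisms between strong components for the two parts preserve adjacency to all spanning
families. -/
theorem exists_blockIso (n : NiceCuts G x X₁ X₂ D D₁ D₂) (hG : IsStablePair G χ G χ c c)
    (h : IsStablePair G χ H ψ c d) (e : c x = d y)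
    (iso₁ : ∀ s ∈ X₁, ∀ t, vertexType c x s = vertexType c x t → D₁.IsoAt G χ G χ x x s t)
    (iso₁' : ∀ s ∈ X₁, ∀ t, vertexType c x s = vertexType d y t → D₁.IsoAt G χ H ψ x y s t)
    (iso₂ : ∀ s ∈ X₂, ∀ t, vertexType c x s = vertexType d y t → D₂.IsoAt G χ H ψ x y s t)
    {s : V} {t : W} (hs : s ∈ SlotCut.reachSet D D₁ D₂ G x)
    (est : vertexType c x s = vertexType d y t) :
    ∃ φ : V → W, φ s = t ∧ Set.BijOn φ (SlotCut.mixedBlock D₁ D₂ G c x (typesIn c x X₁) s)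
        (SlotCut.mixedBlock D₁ D₂ H d y (typesIn c x X₁) t) ∧
      ∀ z ∈ SlotCut.mixedBlock D₁ D₂ G c x (typesIn c x X₁) s,
      ∀ w ∈ SlotCut.mixedBlock D₁ D₂ G c x (typesIn c x X₁) s,
        PreservesPair G χ H ψ x y (SlotCut.slots D D₁ D₂) z w (φ z) (φ w) := by
  have ht : t ∈ SlotCut.reachSet D D₁ D₂ H y := (SlotCut.mem_reachSet_iff h est).mp hs
  have hm := fun z hz => n.mem_mixedBlock (t := z) hG hs hz
  have hm' := fun z hz => n.mem_mixedBlock_right (t := z) hG h e ht hz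
  unfold SlotCut.mixedBlock at hm hm' ⊢
  rw [← est] at hm' ⊢
  obtain ⟨τ, hτ⟩ := h.exists_equiv_vertexType e
  by_cases hS : vertexType c x s ∈ typesIn c x X₁
  · simp only [if_pos hS] at hm hm' ⊢
    obtain ⟨s₀, hs₀, es₀⟩ := hS
    obtain ⟨φ, hφ, hbij, hp⟩ := (iso₁ s₀ hs₀ s es₀).trans_symm (iso₁' s₀ hs₀ t (es₀.trans est))
    refine ⟨φ, hφ, hbij, fun z hz w hw => ?_⟩
    obtain ⟨p1, p2, p3, p4⟩ := hp z hz
    refine ⟨p1, fun i hi => ?_, p4 w hw⟩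
    rcases n.slot_cases₁ hi with ⟨j, rfl⟩ | hi₁
    · exact p2 j
    -- The entry lies outside `X₁`, and both `z` and its image look like vertices of `X₁`. So
    -- adjacency to the entry is the bilinear expression of `D₁`, which is controlled by adjacency
    -- to the columns of `D₁`.
    · obtain ⟨z₀, hz₀, ez₀⟩ := (hm z hz).2.mpr ⟨s₀, hs₀, es₀⟩
      obtain ⟨z₁, hz₁, ez₁⟩ := (hm' (φ z) (hbij.mapsTo hz)).2.mpr ⟨s₀, hs₀, es₀⟩
      exact n.sep₁.adjBit_slot_eq hG h e hz₀ ez₀ hz₁ ez₁ p3 hi₁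
  · simp only [if_neg hS] at hm hm' ⊢
    obtain ⟨φ, hφ, hbij, hp⟩ := iso₂ s (n.mem_of_notMem_typesIn hs hS) t est
    refine ⟨φ, hφ, hbij, fun z hz w hw => ?_⟩
    obtain ⟨p1, p2, p3, p4⟩ := hp z hz
    refine ⟨p1, fun i hi => ?_, p4 w hw⟩
    rcases n.slot_cases₂ hi with ⟨j, rfl⟩ | hi₂
    · exact p2 j
    · have hz₂ : z ∈ X₂ := n.mem_of_notMem_typesIn (hm z hz).1 ((hm z hz).2.not.mpr hS)
      have hz' := hm' (φ z) (hbij.mapsTo hz)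
      obtain ⟨z₁, hz₁⟩ := τ.surjective (φ z)
      have ez₁ : vertexType c x z₁ = vertexType d y (φ z) := hz₁ ▸ hτ z₁
      have hz₁₂ : z₁ ∈ X₂ := n.mem_of_notMem_typesIn
        ((SlotCut.mem_reachSet_iff h ez₁).mpr hz'.1) (by rw [ez₁]; exact hz'.2.not.mpr hS)
      exact n.sep₂.adjBit_slot_eq hG h e hz₂ rfl hz₁₂ ez₁ p3 hi₂

/-- The glued bijection of the reachable sets preserves adjacency to all slots, hence all three
bilinear expressions. Adjacency between vertices of different kinds is the expression of `D₁`;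
between different components of one kind it is given by the child's expression and the ranks. The
arcs of `D` are then preserved, so the bijection restricts to the component of the centre. -/
theorem isoAt_centre [Finite V] [Finite W] (n : NiceCuts G x X₁ X₂ D D₁ D₂)
    (hG : IsStablePair G χ G χ c c) (h : IsStablePair G χ H ψ c d) (e : c x = d y)
    (iso₁ : ∀ s ∈ X₁, ∀ t, vertexType c x s = vertexType c x t → D₁.IsoAt G χ G χ x x s t)
    (iso₁' : ∀ s ∈ X₁, ∀ t, vertexType c x s = vertexType d y t → D₁.IsoAt G χ H ψ x y s t)
    (iso₂ : ∀ s ∈ X₂, ∀ t, vertexType c x s = vertexType d y t → D₂.IsoAt G χ H ψ x y s t) :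
    D.IsoAt G χ H ψ x y (x (Sum.inr 0)) (y (Sum.inr 0)) := by
  have hy : y (Sum.inr 2) = y (Sum.inr 0) := (h.eq_iff e _ _).mp n.spare
  obtain ⟨τ, hτ⟩ := h.exists_equiv_vertexType e
  have hx₀ : x (Sum.inr 0) ∈ SlotCut.reachSet D D₁ D₂ G x := Or.inl Relation.ReflTransGen.refl
  have hy₀ : y (Sum.inr 0) ∈ SlotCut.reachSet D D₁ D₂ H y := Or.inl Relation.ReflTransGen.refl
  obtain ⟨φ, hφ, hbij, hp⟩ := exists_glue (vertexType c x) (vertexType d y)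
    (SlotCut.mixedBlock D₁ D₂ G c x (typesIn c x X₁))
    (SlotCut.mixedBlock D₁ D₂ H d y (typesIn c x X₁))
    (PreservesPair G χ H ψ x y (SlotCut.slots D D₁ D₂)) _
    (SlotCut.reachSet D D₁ D₂ G x) (SlotCut.reachSet D D₁ D₂ H y) rfl
    (fun s _ => SlotCut.mem_mixedBlock_self _ s) (fun s hs t ht => (n.mem_mixedBlock hG hs ht).1)
    (fun s hs t ht => SlotCut.mixedBlock_eq (n.mem_mixedBlock hG hs ht).2 ht)
    (fun s _ => SlotCut.mem_mixedBlock_self _ s)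
    (fun s hs t ht => (n.mem_mixedBlock_right hG h e hs ht).1)
    (fun s hs t ht => SlotCut.mixedBlock_eq (n.mem_mixedBlock_right hG h e hs ht).2 ht)
    (fun r => ncard_eq_of_equiv τ fun z =>
      and_congr (SlotCut.mem_reachSet_iff h (hτ z)) (by rw [hτ z]))
    (fun s _ t _ est r => by
      obtain ⟨σ, hσ⟩ := SlotCut.exists_equiv_mixedBlock (D₁ := D₁) (D₂ := D₂) h n.spare hy
        (typesIn c x X₁) est
      exact ncard_eq_of_equiv σ fun z => and_congr (hσ z).2 (by rw [(hσ z).1]))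
    (fun s hs t _ est => n.exists_blockIso hG h e iso₁ iso₁' iso₂ hs est)
    _ hx₀ _ hy₀ (h.vertexType_entry e _)
  have hcol : ∀ z ∈ SlotCut.reachSet D D₁ D₂ G x, χ z = ψ (φ z) := fun z hz => by
    obtain ⟨s, -, t, -, -, hzs, -, hq⟩ := hp z hz
    exact (hq z hzs z hzs).1
  have hslot : ∀ z ∈ SlotCut.reachSet D D₁ D₂ G x, ∀ i ∈ SlotCut.slots D D₁ D₂,
      adjBit G z (x (Sum.inl i)) = adjBit H (φ z) (y (Sum.inl i)) := fun z hz => by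
    obtain ⟨s, -, t, -, -, hzs, -, hq⟩ := hp z hz
    exact (hq z hzs z hzs).2.1
  have hkind : ∀ z ∈ SlotCut.reachSet D D₁ D₂ G x,
      (vertexType d y (φ z) ∈ typesIn c x X₁ ↔ vertexType c x z ∈ typesIn c x X₁) :=
    -- The glued bijection is not known to preserve types, so the kinds of `z` and of its image are
    -- compared through the representatives of their blocks.
    fun z hz => by
    obtain ⟨s, hs, t, ht, est, hzs, hb, -⟩ := hp z hz
    rw [(n.mem_mixedBlock_right hG h e ht (hb.mapsTo hzs)).2, (n.mem_mixedBlock hG hs hzs).2, est]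
  have hbit₁ : ∀ z ∈ SlotCut.reachSet D D₁ D₂ G x, ∀ w ∈ SlotCut.reachSet D D₁ D₂ G x,
      D₁.bit G x z w = D₁.bit H y (φ z) (φ w) := fun z hz w hw =>
    SlotCut.bit_eq_bit (fun j => hslot z hz _ (n.col₁_mem_slots j))
      fun i => hslot w hw _ (row₁_mem_slots i)
  have hbit₂ : ∀ z ∈ SlotCut.reachSet D D₁ D₂ G x, ∀ w ∈ SlotCut.reachSet D D₁ D₂ G x,
      D₂.bit G x z w = D₂.bit H y (φ z) (φ w) := fun z hz w hw =>
    SlotCut.bit_eq_bit (fun j => hslot z hz _ (n.col₂_mem_slots j))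
      fun i => hslot w hw _ (row₂_mem_slots i)
  have hbit : ∀ z ∈ SlotCut.reachSet D D₁ D₂ G x, ∀ w ∈ SlotCut.reachSet D D₁ D₂ G x,
      D.bit G x z w = D.bit H y (φ z) (φ w) := fun z hz w hw =>
    SlotCut.bit_eq_bit (fun j => hslot z hz _ (col_mem_slots j))
      fun i => hslot w hw _ (n.row_mem_slots i)
  have hcross : ∀ z ∈ SlotCut.reachSet D D₁ D₂ G x, ∀ w ∈ SlotCut.reachSet D D₁ D₂ G x,
      vertexType c x z ∈ typesIn c x X₁ → vertexType c x w ∉ typesIn c x X₁ →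
      adjBit G z w = adjBit H (φ z) (φ w) := fun z hz w hw hz₁ hw₁ => by
    have g1 : adjBit G z w = D₁.bit G x z w := not_not.mp (n.not_arc hG rfl hw hz₁ hw₁)
    have g2 : adjBit H (φ z) (φ w) = D₁.bit H y (φ z) (φ w) :=
      not_not.mp (n.not_arc h e (hbij.mapsTo hw) ((hkind z hz).mpr hz₁) ((hkind w hw).not.mpr hw₁))
    rw [g1, g2]
    exact hbit₁ z hz w hw
  have hadj : ∀ z ∈ SlotCut.reachSet D D₁ D₂ G x, ∀ w ∈ SlotCut.reachSet D D₁ D₂ G x,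
      adjBit G z w = adjBit H (φ z) (φ w) := fun z hz w hw => by
    by_cases hz₁ : vertexType c x z ∈ typesIn c x X₁ <;>
      by_cases hw₁ : vertexType c x w ∈ typesIn c x X₁
    on_goal 2 => exact hcross z hz w hw hz₁ hw₁
    on_goal 2 =>
      rw [adjBit_comm, adjBit_comm H]
      exact hcross w hw z hz hw₁ hz₁
    all_goals
      obtain ⟨s, hs, s', hs', es, hzs, hbs, hq⟩ := hp z hz
      obtain ⟨t, ht, t', ht', et, hwt, hbt, -⟩ := hp w hw
      by_cases hws : w ∈ SlotCut.mixedBlock D₁ D₂ G c x (typesIn c x X₁) s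
      · exact (hq z hzs w hws).2.2
      have hws' : φ w ∉ SlotCut.mixedBlock D₁ D₂ H d y (typesIn c x X₁) s' := fun hmem => by
        obtain ⟨w', hw', hww⟩ := hbs.surjOn hmem
        exact hws (hbij.injOn (n.mem_mixedBlock hG hs hw').1 hw hww ▸ hw')
      have ks := (n.mem_mixedBlock hG hs hzs).2
      have kt := (n.mem_mixedBlock hG ht hwt).2
      have hzs' := hbs.mapsTo hzs
      have hwt' := hbt.mapsTo hwt
      unfold SlotCut.mixedBlock at hzs hwt hzs' hwt' hws hws'
      rw [← es] at hzs' hws'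
      rw [← et] at hwt'
    · simp only [if_pos (ks.mp hz₁), if_pos (kt.mp hw₁)] at hzs hwt hzs' hwt' hws hws'
      refine SlotCut.adjBit_eq_of_notMem_block h n.spare hy es hzs hzs' et hwt hwt' ?_ ?_
        (hbit₁ z hz w hw) (hbit₁ w hw z hz)
      · exact fun hm => hws (hzs.elim fun a b => ⟨a.trans hm.1, hm.2.trans b⟩)
      · exact fun hm => hws' (hzs'.elim fun a b => ⟨a.trans hm.1, hm.2.trans b⟩)
    · simp only [if_neg (ks.not.mp hz₁), if_neg (kt.not.mp hw₁)] at hzs hwt hzs' hwt' hws hws'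
      refine SlotCut.adjBit_eq_of_notMem_block h n.spare hy es hzs hzs' et hwt hwt' ?_ ?_
        (hbit₂ z hz w hw) (hbit₂ w hw z hz)
      · exact fun hm => hws (hzs.elim fun a b => ⟨a.trans hm.1, hm.2.trans b⟩)
      · exact fun hm => hws' (hzs'.elim fun a b => ⟨a.trans hm.1, hm.2.trans b⟩)
  have hsub : D.block G x (x (Sum.inr 0)) ⊆ SlotCut.reachSet D D₁ D₂ G x :=
    fun z hz => SlotCut.reachSet_closed hx₀ hz.1
  refine ⟨φ, hφ, ?_, fun z hz => ⟨hcol z (hsub hz), fun i => hslot z (hsub hz) _ (n.row_mem_slots i),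
    fun j => hslot z (hsub hz) _ (col_mem_slots j), fun w hw => hadj z (hsub hz) w (hsub hw)⟩⟩
  rw [← hφ]
  refine SlotCut.bijOn_block hbij (fun s hs t ht => SlotCut.reachSet_closed hs ht)
    (fun s hs t ht => SlotCut.reachSet_closed hs ht) (fun s hs t ht => ?_) hx₀
  have h1 := hadj s hs t ht
  have h2 := hbit s hs t ht
  change adjBit G s t ≠ D.bit G x s t ↔ adjBit H (φ s) (φ t) ≠ D.bit H y (φ s) (φ t)
  rw [h1, h2]

end NiceCuts

/-! ## Induction along the decomposition tree -/

theorem SlotCut.IsoAt.congr {N m : ℕ} {V : Type u} {W : Type v} {C : Type w}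
    {G : SimpleGraph V} {χ : V → C} {H : SimpleGraph W} {ψ : W → C} {x x' : Slot N → V}
    {y y' : Slot N → W} {α α' : Fin N → Fin 3 × Fin N} {β β' : Fin m → Fin 3 × Fin N}
    {L : Matrix (Fin m) (Fin N) (ZMod 2)} {s : V} {t : W}
    (h : (⟨m, α, β, L⟩ : SlotCut N).IsoAt G χ H ψ x y s t)
    (hα : x ∘ Sum.inl ∘ α = x' ∘ Sum.inl ∘ α') (hβ : x ∘ Sum.inl ∘ β = x' ∘ Sum.inl ∘ β')
    (hα' : y ∘ Sum.inl ∘ α = y' ∘ Sum.inl ∘ α') (hβ' : y ∘ Sum.inl ∘ β = y' ∘ Sum.inl ∘ β') :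
    (⟨m, α', β', L⟩ : SlotCut N).IsoAt G χ H ψ x' y' s t := by
  unfold SlotCut.IsoAt SlotCut.block SlotCut.row SlotCut.col at h ⊢
  dsimp only at h ⊢
  rw [hα, hβ, hα', hβ'] at h
  exact h

section Tree

variable {N : ℕ} {V : Type u} {W : Type v} {C : Type w} {T : Type*}
variable {G : SimpleGraph V} {χ : V → C} {H : SimpleGraph W} {ψ : W → C} {c : (Slot N → V) → T}
  {d : (Slot N → W) → T}

/-- Whenever the spanning families `a` and `b` of a cut and a vertex of `X` are entries of a tuple,
the strong component of the vertex is mapped isomorphically for every tuple of the same colour. -/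
def BlockIso (G : SimpleGraph V) (χ : V → C) (H : SimpleGraph W) (ψ : W → C)
    (c : (Slot N → V) → T) (d : (Slot N → W) → T) (X : Set V) (a : Fin N → V) {m : ℕ}
    (b : Fin m → V) (L : Matrix (Fin m) (Fin N) (ZMod 2)) : Prop :=
  ∀ (x : Slot N → V) (y : Slot N → W) (α : Fin N → Fin 3 × Fin N) (β : Fin m → Fin 3 × Fin N)
    (p : Slot N), c x = d y → x ∘ Sum.inl ∘ α = a → x ∘ Sum.inl ∘ β = b → x p ∈ X →
    (⟨m, α, β, L⟩ : SlotCut N).IsoAt G χ H ψ x y (x p) (y p)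

/-- Entry `1` is moved to the vertex in question; the entries that hold the families stay in place.
-/
theorem BlockIso.of_vertexType {X : Set V} {a : Fin N → V} {m : ℕ}
    {b : Fin m → V} {L : Matrix (Fin m) (Fin N) (ZMod 2)} (h : BlockIso G χ H ψ c d X a b L)
    {x : Slot N → V} {y : Slot N → W} {α : Fin N → Fin 3 × Fin N} {β : Fin m → Fin 3 × Fin N}
    (ha : x ∘ Sum.inl ∘ α = a) (hb : x ∘ Sum.inl ∘ β = b) {s : V} (hs : s ∈ X) {t : W}
    (e : vertexType c x s = vertexType d y t) :
    (⟨m, α, β, L⟩ : SlotCut N).IsoAt G χ H ψ x y s t := by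
  have := h (Function.update x (Sum.inr 1) s) (Function.update y (Sum.inr 1) t) α β (Sum.inr 1) e
    (by rwa [update_comp_inl]) (by rwa [update_comp_inl]) (by simpa using hs)
  simp only [Function.update_self] at this
  exact this.congr (update_comp_inl ..) (update_comp_inl ..) (update_comp_inl ..)
    (update_comp_inl ..)

theorem blockIso_union [Finite V] [Finite W] (hG : IsStablePair G χ G χ c c)
    (h : IsStablePair G χ H ψ c d) {X₁ X₂ : Set V} (hdisj : Disjoint X₁ X₂) {a₁ a₂ : Fin N → V}
    (ha₁ : ∀ i, a₁ i ∈ X₁) (ha₂ : ∀ i, a₂ i ∈ X₂) {m : ℕ} (hm : m ≤ N) {b : Fin m → V}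
    (hb : ∀ j, b j ∉ X₁ ∪ X₂) (τ : Fin N → Fin N ⊕ Fin N) (τ₁ τ₂ : Fin N → Fin N ⊕ Fin m)
    {L : Matrix (Fin m) (Fin N) (ZMod 2)} {L₁ L₂ : Matrix (Fin N) (Fin N) (ZMod 2)}
    (hL : ∀ s ∈ X₁ ∪ X₂, ∀ t ∉ X₁ ∪ X₂, adjBit G s t = flipBit G (Sum.elim a₁ a₂ ∘ τ) b L s t)
    (hL₁ : ∀ s ∈ X₁, ∀ t ∉ X₁, adjBit G s t = flipBit G a₁ (Sum.elim a₂ b ∘ τ₁) L₁ s t)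
    (hL₂ : ∀ s ∈ X₂, ∀ t ∉ X₂, adjBit G s t = flipBit G a₂ (Sum.elim a₁ b ∘ τ₂) L₂ s t)
    (iso₁ : BlockIso G χ G χ c c X₁ a₁ (Sum.elim a₂ b ∘ τ₁) L₁)
    (iso₁' : BlockIso G χ H ψ c d X₁ a₁ (Sum.elim a₂ b ∘ τ₁) L₁)
    (iso₂ : BlockIso G χ H ψ c d X₂ a₂ (Sum.elim a₁ b ∘ τ₂) L₂) :
    BlockIso G χ H ψ c d (X₁ ∪ X₂) (Sum.elim a₁ a₂ ∘ τ) b L := by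
  classical
  intro x y α β p e hα hβ hp
  -- The first family holds `a₁`, the second `a₂`, the third `b`, padded with the centre if `m < N`.
  -- All four further entries hold the centre, so entries `0` and `2` agree as `NiceCuts` requires.
  let x' : Slot N → V := Sum.elim (fun q => if q.1 = 0 then a₁ q.2 else if q.1 = 1 then a₂ q.2
    else if hq : (q.2 : ℕ) < m then b ⟨q.2, hq⟩ else x p) fun _ => x p
  let γ₁ : Fin N → Fin 3 × Fin N := fun i => (0, i)
  let γ₂ : Fin N → Fin 3 × Fin N := fun i => (1, i)
  let γ : Fin m → Fin 3 × Fin N := fun j => (2, Fin.castLE hm j)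
  have hx₁ : x' ∘ Sum.inl ∘ γ₁ = a₁ := by
    ext i
    simp [x', γ₁]
  have hx₂ : x' ∘ Sum.inl ∘ γ₂ = a₂ := by
    ext i
    simp [x', γ₂]
  have hx₃ : x' ∘ Sum.inl ∘ γ = b := by
    ext j
    simp [x', γ]
  have hpair : ∀ {n₁ n₂ n₃ : ℕ} (δ₁ : Fin n₁ → Fin 3 × Fin N) (δ₂ : Fin n₂ → Fin 3 × Fin N)
      (θ : Fin n₃ → Fin n₁ ⊕ Fin n₂), x' ∘ Sum.inl ∘ (Sum.elim δ₁ δ₂ ∘ θ) =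
        Sum.elim (x' ∘ Sum.inl ∘ δ₁) (x' ∘ Sum.inl ∘ δ₂) ∘ θ := fun δ₁ δ₂ θ => by
    ext i
    simp only [Function.comp_apply]
    rcases θ i with j | j <;> rfl
  have hrange : ∀ {n₁ n₂ n₃ : ℕ} (δ₁ : Fin n₁ → Fin 3 × Fin N) (δ₂ : Fin n₂ → Fin 3 × Fin N)
      (θ : Fin n₃ → Fin n₁ ⊕ Fin n₂),
      Set.range (Sum.elim δ₁ δ₂ ∘ θ) ⊆ Set.range δ₁ ∪ Set.range δ₂ := fun δ₁ δ₂ θ => by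
    rw [← Set.Sum.elim_range]
    exact Set.range_comp_subset_range _ _
  let D : Finset V := ((Finset.univ.image a₁ ∪ Finset.univ.image a₂) ∪ Finset.univ.image b) ∪ {x p}
  -- What counts is the number of distinct vertices, here at most `3N + 1`. The row vertices of the
  -- parent cost nothing because they are taken from `a₁` and `a₂`.
  have hD : D.card ≤ Fintype.card (Slot N) := by
    have h1 : (Finset.univ.image a₁).card ≤ N := Finset.card_image_le.trans (by simp)
    have h2 : (Finset.univ.image a₂).card ≤ N := Finset.card_image_le.trans (by simp)
    have h3 : (Finset.univ.image b).card ≤ m := Finset.card_image_le.trans (by simp)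
    have h4 : D.card ≤ _ := Finset.card_union_le _ _
    have h5 := Finset.card_union_le (Finset.univ.image a₁ ∪ Finset.univ.image a₂)
      (Finset.univ.image b)
    have h6 := Finset.card_union_le (Finset.univ.image a₁) (Finset.univ.image a₂)
    simp only [Finset.card_singleton] at h4
    simp only [Fintype.card_sum, Fintype.card_prod, Fintype.card_fin]
    omega
  have hDa₁ : ∀ i, a₁ i ∈ D := fun i => by simp [D]
  have hDa₂ : ∀ i, a₂ i ∈ D := fun i => by simp [D]
  have hDb : ∀ j, b j ∈ D := fun j => by simp [D]
  have hDp : x p ∈ D := by simp [D]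
  obtain ⟨y', e', hy'⟩ := h.exists_tuple e (x' := x') D hD
    (by
      rintro (q | q)
      · simp only [x', Sum.elim_inl]
        split_ifs
        exacts [hDa₁ _, hDa₂ _, hDb _, hDp]
      · exact hDp)
    (Set.range (Sum.inl ∘ α) ∪ Set.range (Sum.inl ∘ β) ∪ {p})
    (by
      rintro i ((⟨j, rfl⟩ | ⟨j, rfl⟩) | rfl)
      · have : (x ∘ Sum.inl ∘ α) j ∈ D := by
          rw [hα, Function.comp_apply]
          rcases τ j with l | l
          exacts [hDa₁ l, hDa₂ l]
        exact this
      · have : (x ∘ Sum.inl ∘ β) j ∈ D := by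
          rw [hβ]
          exact hDb j
        exact this
      · exact hDp)
  have hα₁ : x' ∘ Sum.inl ∘ (Sum.elim γ₁ γ₂ ∘ τ) = x ∘ Sum.inl ∘ α := by
    rw [hpair, hx₁, hx₂, hα]
  have hβ₁ : x' ∘ Sum.inl ∘ γ = x ∘ Sum.inl ∘ β := by rw [hx₃, hβ]
  have hα' : y' ∘ Sum.inl ∘ (Sum.elim γ₁ γ₂ ∘ τ) = y ∘ Sum.inl ∘ α := by
    ext i
    exact hy' _ _ (Or.inl (Or.inl ⟨i, rfl⟩)) (congrFun hα₁ i)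
  have hβ' : y' ∘ Sum.inl ∘ γ = y ∘ Sum.inl ∘ β := by
    ext i
    exact hy' _ _ (Or.inl (Or.inr ⟨i, rfl⟩)) (congrFun hβ₁ i)
  have hp' : y' (Sum.inr 0) = y p := hy' _ _ (Or.inr rfl) rfl
  have n : NiceCuts G x' X₁ X₂ ⟨m, Sum.elim γ₁ γ₂ ∘ τ, γ, L⟩
      ⟨N, γ₁, Sum.elim γ₂ γ ∘ τ₁, L₁⟩ ⟨N, γ₂, Sum.elim γ₁ γ ∘ τ₂, L₂⟩ :=
    { disj := hdisj
      sep := by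
        unfold SlotCut.Separates SlotCut.bit SlotCut.row SlotCut.col
        dsimp only
        rw [hpair, hx₁, hx₂, hx₃]
        exact hL
      sep₁ := by
        unfold SlotCut.Separates SlotCut.bit SlotCut.row SlotCut.col
        dsimp only
        rw [hpair, hx₁, hx₂, hx₃]
        exact hL₁
      sep₂ := by
        unfold SlotCut.Separates SlotCut.bit SlotCut.row SlotCut.col
        dsimp only
        rw [hpair, hx₁, hx₂, hx₃]
        exact hL₂
      row_mem₁ := by
        unfold SlotCut.row
        dsimp only
        rw [hx₁]
        exact ha₁
      row_mem₂ := by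
        unfold SlotCut.row
        dsimp only
        rw [hx₂]
        exact ha₂
      col_notMem := by
        unfold SlotCut.col
        dsimp only
        rw [hx₃]
        exact hb
      row_slot := hrange _ _ _
      col_slot₁ := hrange _ _ _
      col_slot₂ := hrange _ _ _
      centre_mem := hp
      spare := rfl }
  have hb₁ : x' ∘ Sum.inl ∘ (Sum.elim γ₂ γ ∘ τ₁) = Sum.elim a₂ b ∘ τ₁ := by rw [hpair, hx₂, hx₃]
  have hb₂ : x' ∘ Sum.inl ∘ (Sum.elim γ₁ γ ∘ τ₂) = Sum.elim a₁ b ∘ τ₂ := by rw [hpair, hx₁, hx₃]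
  have key := n.isoAt_centre hG h e' (fun s hs t est => iso₁.of_vertexType hx₁ hb₁ hs est)
    (fun s hs t est => iso₁'.of_vertexType hx₁ hb₁ hs est)
    (fun s hs t est => iso₂.of_vertexType hx₂ hb₂ hs est)
  rw [hp'] at key
  exact key.congr hα₁ hβ₁ hα' hβ'

/-- No arc leaves the singleton, so the component of its vertex is trivial. Its counterpart in `H`
is trivial as well, since equal colours have the same reachability and equality patterns. -/
theorem blockIso_singleton (h : IsStablePair G χ H ψ c d) {s : V} {a : Fin N → V}
    {m : ℕ} {b : Fin m → V} {L : Matrix (Fin m) (Fin N) (ZMod 2)}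
    (hL : ∀ z ∈ ({s} : Set V), ∀ t ∉ ({s} : Set V), adjBit G z t = flipBit G a b L z t) :
    BlockIso G χ H ψ c d {s} a b L := by
  rintro x y α β p e rfl rfl rfl
  have hr : ∀ t, FlipReach G (x ∘ Sum.inl ∘ α) (x ∘ Sum.inl ∘ β) L (x p) t → t = x p :=
    fun t ht => FlipReach.mem hL ht rfl
  have hr' : ∀ t, FlipReach H (y ∘ Sum.inl ∘ α) (y ∘ Sum.inl ∘ β) L (y p) t → t = y p := by
    intro t ht
    obtain ⟨q, hq⟩ : ∃ q : Fin 4, (Sum.inr q : Slot N) ≠ p := by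
      rcases p with p | p
      · exact ⟨0, by simp⟩
      · obtain ⟨q, hq⟩ := exists_ne p
        exact ⟨q, by simpa using hq⟩
    obtain ⟨σ, hσ⟩ := h.extend e
    obtain ⟨z, rfl⟩ := σ.surjective t
    have h1 := h.flipReach_iff (hσ (Sum.inr q) z) α β L p (Sum.inr q)
    have h2 := h.eq_iff (hσ (Sum.inr q) z) (Sum.inr q) p
    simp only [update_comp_inl, Function.update_of_ne hq.symm, Function.update_self] at h1 h2
    exact h2.mp (hr z (h1.mpr ht))
  have hblock : SlotCut.block ⟨m, α, β, L⟩ G x (x p) = {x p} :=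
    Set.Subset.antisymm (fun t ht => hr t ht.1) (by rintro _ rfl; exact mem_flipBlock_self _)
  have hblock' : SlotCut.block ⟨m, α, β, L⟩ H y (y p) = {y p} :=
    Set.Subset.antisymm (fun t ht => hr' t ht.1) (by rintro _ rfl; exact mem_flipBlock_self _)
  refine ⟨fun _ => y p, rfl, ?_, ?_⟩
  · rw [hblock, hblock']
    exact Set.bijOn_singleton.mpr rfl
  · rw [hblock]
    rintro z rfl
    refine ⟨h.colour e p, fun i => h.adjBit_eq e _ _, fun j => h.adjBit_eq e _ _, ?_⟩
    rintro w rfl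
    exact h.adjBit_eq e _ _

/-- The induction hypothesis for the nodes of a decomposition tree. -/
def HasBlockIso (G : SimpleGraph V) (χ : V → C) (H : SimpleGraph W) (ψ : W → C)
    (c : (Slot N → V) → T) (d : (Slot N → W) → T) (X : Set V) : Prop :=
  ∃ a : Fin N → V, (∀ i, a i ∈ X) ∧ SpansCut G a X ∧ ∀ m ≤ N, ∀ b : Fin m → V, (∀ j, b j ∉ X) →
    SpansCut G b Xᶜ → ∀ L : Matrix (Fin m) (Fin N) (ZMod 2),
    (∀ s ∈ X, ∀ t ∉ X, adjBit G s t = flipBit G a b L s t) →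
    BlockIso G χ G χ c c X a b L ∧ BlockIso G χ H ψ c d X a b L

theorem SpansCut.union {X₁ X₂ : Set V} {ι κ : Type*} [Fintype ι] [Fintype κ] {a : ι → V}
    {b : κ → V} (ha : SpansCut G a X₁) (hb : SpansCut G b X₂) :
    SpansCut G (Sum.elim a b) (X₁ ∪ X₂) := by
  rintro x (hx | hx)
  · obtain ⟨p, hp⟩ := ha x hx
    refine ⟨Sum.elim p 0, fun y hy => ?_⟩
    rw [hp y fun h => hy (Or.inl h)]
    simp
  · obtain ⟨p, hp⟩ := hb x hx
    refine ⟨Sum.elim 0 p, fun y hy => ?_⟩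
    rw [hp y fun h => hy (Or.inr h)]
    simp

/-- The complement of `X₁` consists of `X₂` and the complement of the union, so `a₂` and `b`
together span its rows. As a cut and its complement have the same rank, `N` of these vertices
suffice. -/
theorem exists_flip_of_union [Fintype V] {X₁ X₂ : Set V} (hdisj : Disjoint X₁ X₂)
    {a₁ a₂ : Fin N → V} (ha₁ : ∀ i, a₁ i ∈ X₁) (ha₂ : ∀ i, a₂ i ∈ X₂) (hs₁ : SpansCut G a₁ X₁)
    (hs₂ : SpansCut G a₂ X₂) {m : ℕ} {b : Fin m → V} (hb : ∀ j, b j ∉ X₁ ∪ X₂)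
    (hsb : SpansCut G b (X₁ ∪ X₂)ᶜ) (hrank : cutRank G X₁ ≤ N) :
    ∃ (τ : Fin N → Fin N ⊕ Fin m) (L : Matrix (Fin N) (Fin N) (ZMod 2)),
      (∀ j, (Sum.elim a₂ b ∘ τ) j ∉ X₁) ∧ SpansCut G (Sum.elim a₂ b ∘ τ) X₁ᶜ ∧
      ∀ s ∈ X₁, ∀ t ∉ X₁, adjBit G s t = flipBit G a₁ (Sum.elim a₂ b ∘ τ) L s t := by
  have hcompl : X₁ᶜ = X₂ ∪ (X₁ ∪ X₂)ᶜ := by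
    ext z
    have : z ∈ X₁ → z ∉ X₂ := fun h => Set.disjoint_left.mp hdisj h
    simp only [Set.mem_compl_iff, Set.mem_union]
    tauto
  have hspan : SpansCut G (Sum.elim a₂ b) X₁ᶜ := hcompl ▸ hs₂.union hsb
  have hmem : ∀ t, Sum.elim a₂ b t ∈ X₁ᶜ := by
    rintro (i | j)
    · exact fun h => Set.disjoint_left.mp hdisj h (ha₂ i)
    · exact fun h => hb j (Or.inl h)
  obtain ⟨τ, hτ⟩ := hspan.exists_fin hmem (k := N) ((cutRank_compl G X₁).trans_le hrank)
    fun h0 => ⟨Sum.inl ⟨0, h0⟩⟩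
  obtain ⟨L, hL⟩ := exists_flipBit_eq_adjBit ha₁ (fun j => hmem (τ j)) hs₁ hτ
  exact ⟨τ, L, fun j => hmem (τ j), hτ, hL⟩

/-- The family `a` is built upwards from the leaves, before anything outside the node is fixed; the
family `b` comes from above and must therefore be arbitrary. The isomorphisms from `G` to itself are
carried along because vertices outside `X₁` may have types that occur in `X₁`. -/
theorem hasBlockIso_of_decompositionTree [Fintype V] [Finite W] (hG : IsStablePair G χ G χ c c)
    (h : IsStablePair G χ H ψ c d) {X : Set V} (t : DecompositionTree X) (ht : t.width G ≤ N) :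
    HasBlockIso G χ H ψ c d X := by
  induction t with
  | leaf s =>
    have hspan : SpansCut G (fun _ : Unit => s) {s} := by
      rintro _ rfl
      exact ⟨fun _ => 1, fun y _ => by simp⟩
    obtain ⟨τ, hτ⟩ := hspan.exists_fin (fun _ => rfl) (k := N)
      ht fun _ => inferInstance
    exact ⟨_, fun _ => rfl, hτ, fun m _ b _ _ L hL =>
      ⟨blockIso_singleton hG hL, blockIso_singleton h hL⟩⟩
  | @node X₁ X₂ t₁ t₂ hdisj ih₁ ih₂ =>
    simp only [DecompositionTree.width, max_le_iff] at ht
    obtain ⟨hX, ht₁, ht₂⟩ := ht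
    have hrank : ∀ {X : Set V} (t : DecompositionTree X), t.width G ≤ N → cutRank G X ≤ N := by
      rintro _ (_ | _) ht
      · exact ht
      · exact (le_max_left _ _).trans ht
    obtain ⟨a₁, ha₁, hs₁, iso₁⟩ := ih₁ ht₁
    obtain ⟨a₂, ha₂, hs₂, iso₂⟩ := ih₂ ht₂
    obtain ⟨τ, hτ⟩ := (hs₁.union hs₂).exists_fin (k := N)
      (by
        rintro (i | i)
        exacts [Or.inl (ha₁ i), Or.inr (ha₂ i)])
      hX fun h0 => ⟨Sum.inl ⟨0, h0⟩⟩
    refine ⟨Sum.elim a₁ a₂ ∘ τ, fun i => ?_, hτ, fun m hm b hb hsb L hL => ?_⟩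
    · rw [Function.comp_apply]
      rcases τ i with j | j
      exacts [Or.inl (ha₁ j), Or.inr (ha₂ j)]
    · obtain ⟨τ₁, L₁, hb₁, hsb₁, hL₁⟩ :=
        exists_flip_of_union hdisj ha₁ ha₂ hs₁ hs₂ hb hsb (hrank t₁ ht₁)
      obtain ⟨τ₂, L₂, hb₂, hsb₂, hL₂⟩ :=
        exists_flip_of_union hdisj.symm ha₂ ha₁ hs₂ hs₁ (b := b)
          (fun j => by rw [Set.union_comm]; exact hb j) (by rwa [Set.union_comm]) (hrank t₂ ht₂)
      have i₁ := iso₁ N le_rfl _ hb₁ hsb₁ L₁ hL₁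
      have i₂ := iso₂ N le_rfl _ hb₂ hsb₂ L₂ hL₂
      exact ⟨blockIso_union hG hG hdisj ha₁ ha₂ hm hb τ τ₁ τ₂ hL hL₁ hL₂ i₁.1 i₁.1 i₂.1,
        blockIso_union hG h hdisj ha₁ ha₂ hm hb τ τ₁ τ₂ hL hL₁ hL₂ i₁.1 i₁.2 i₂.2⟩

/-- Graphs with tuples of the same stable colour are isomorphic, if one of them has a decomposition
of small width. -/
theorem colouredIso_of_isStablePair [Fintype V] [Finite W] (hG : IsStablePair G χ G χ c c)
    (h : IsStablePair G χ H ψ c d) (t : DecompositionTree (Set.univ : Set V))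
    (ht : t.width G ≤ N) [Nonempty V] (hcd : ∀ x, ∃ y, c x = d y) : ColouredIso G χ H ψ := by
  obtain ⟨a, -, -, iso⟩ := hasBlockIso_of_decompositionTree hG h t ht
  -- Nothing lies outside the root's set, so the empty column family and `L = 0` are admissible and
  -- the arcs are the edges of `G`.
  obtain ⟨-, iso⟩ := iso 0 (Nat.zero_le N) Fin.elim0 (fun j => j.elim0)
    (fun x hx => absurd (Set.mem_univ x) hx) 0 (fun s _ t ht => absurd (Set.mem_univ t) ht)
  obtain ⟨v₀⟩ := ‹Nonempty V›
  let x : Slot N → V := Sum.elim (fun q => a q.2) fun _ => v₀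
  obtain ⟨y, e⟩ := hcd x
  let D : SlotCut N := ⟨0, fun i => (0, i), Fin.elim0, 0⟩
  have hy : y (Sum.inr 2) = y (Sum.inr 0) := (h.eq_iff e _ _).mp rfl
  obtain ⟨τ, hτ⟩ := h.exists_equiv_vertexType e
  obtain ⟨φ, -, hbij, hp⟩ := exists_glue (vertexType c x) (vertexType d y)
    (D.block G x) (D.block H y) (PreservesPair G χ H ψ x y ∅) _ Set.univ Set.univ rfl
    (fun s _ => mem_flipBlock_self s) (fun s _ => Set.subset_univ _)
    (fun s _ t ht => flipBlock_eq ht) (fun s _ => mem_flipBlock_self s)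
    (fun s _ => Set.subset_univ _) (fun s _ t ht => flipBlock_eq ht)
    (fun r => ncard_eq_of_equiv τ fun z => by simp [hτ z])
    (fun s _ t _ est r => by
      obtain ⟨σ, hσ⟩ := h.exists_equiv_of_vertexType rfl hy est
      exact ncard_eq_of_equiv σ fun z =>
        and_congr ((hσ z).2 _ _ D.α D.β D.L).2.1 (by rw [(hσ z).1]))
    (fun s _ t _ est => by
      obtain ⟨φ, hφ, hb, hp⟩ := iso.of_vertexType (x := x) (y := y) (α := D.α) (β := D.β) rfl
        (by ext j; exact j.elim0) (Set.mem_univ s) est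
      exact ⟨φ, hφ, hb, fun z hz w hw =>
        ⟨(hp z hz).1, fun i hi => absurd hi (Set.notMem_empty i), (hp z hz).2.2.2 w hw⟩⟩)
    (x (Sum.inr 0)) (Set.mem_univ _) (y (Sum.inr 0)) (Set.mem_univ _) (h.vertexType_entry e _)
  -- With the zero expression, different strong components have no edges between them, in `G` as in
  -- `H`.
  have hzero : ∀ s t, t ∉ D.block G x s → adjBit G s t = 0 := fun s t hst => by
    rw [adjBit_eq_of_notMem_flipBlock hst]
    simp [flipBit, D]
  have hzero' : ∀ s t, t ∉ D.block H y s → adjBit H s t = 0 := fun s t hst => by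
    rw [adjBit_eq_of_notMem_flipBlock hst]
    simp [flipBit, D]
  have hadj : ∀ s t, adjBit G s t = adjBit H (φ s) (φ t) := fun s t => by
    obtain ⟨s₀, -, s₁, -, -, hs, hb, hq⟩ := hp s (Set.mem_univ s)
    by_cases hts : t ∈ D.block G x s₀
    · exact (hq s hs t hts).2.2
    · rw [hzero s t fun hm => hts ((flipBlock_eq hs).subset hm), hzero' (φ s) (φ t)]
      intro hm
      obtain ⟨t', ht', htt⟩ := hb.surjOn ((flipBlock_eq (hb.mapsTo hs)).subset hm)
      exact hts (hbij.injOn (Set.mem_univ t') (Set.mem_univ t) htt ▸ ht')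
  refine ⟨⟨Equiv.ofBijective φ (Set.bijOn_univ.mp hbij), ?_⟩, fun s => ?_⟩
  · intro s t
    exact (adjBit_eq_adjBit_iff.mp (hadj s t)).symm
  · obtain ⟨s₀, -, s₁, -, -, hs, -, hq⟩ := hp s (Set.mem_univ s)
    exact (hq s hs s hs).1.symm

end Tree

/-! ## The stable colouring of the Weisfeiler-Leman algorithm -/

section WL

variable {V : Type u} {W : Type v} {C : Type w} [Fintype V] [Fintype W] {G : SimpleGraph V}
  {χ : V → C} {H : SimpleGraph W} {ψ : W → C} {ℓ : ℕ}

theorem wlColouring_zero_eq {i : ℕ} {x : Fin ℓ → V} {y : Fin ℓ → W}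
    (h : wlColouring ℓ G χ i x = wlColouring ℓ H ψ i y) :
    wlColouring ℓ G χ 0 x = wlColouring ℓ H ψ 0 y := by
  induction i with
  | zero => exact h
  | succ i ih => exact ih (congrArg Prod.fst h)

theorem exists_equiv_of_wlColouring_succ {i : ℕ} {x : Fin ℓ → V} {y : Fin ℓ → W}
    (h : wlColouring ℓ G χ (i + 1) x = wlColouring ℓ H ψ (i + 1) y) :
    ∃ σ : V ≃ W, ∀ a w, wlColouring ℓ G χ i (Function.update x a w) =
      wlColouring ℓ H ψ i (Function.update y a (σ w)) := by
  obtain ⟨σ, hσ⟩ := exists_equiv_of_map_univ_eq (congrArg Prod.snd h)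
  exact ⟨σ, fun a w => congrFun (hσ w) a⟩

/-- Replacing entry `a` of `x ∘ f` must come from replacing a single entry `b` of `x` that no other
position uses: this is `f a` if `f` is a permutation, and any value missed by `f` otherwise. -/
theorem exists_update_comp {I : Type*} [Finite I] [DecidableEq I] (f : I → I) (a : I) :
    ∃ (b : I) (g : I → I), g a = b ∧ ∀ i, i ≠ a → g i = f i ∧ f i ≠ b := by
  by_cases hf : Function.Surjective f
  · exact ⟨f a, f, rfl, fun i hi => ⟨rfl, fun h => hi (Finite.injective_iff_surjective.mpr hf h)⟩⟩
  · unfold Function.Surjective at hf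
    push Not at hf
    obtain ⟨b, hb⟩ := hf
    exact ⟨b, Function.update f a b, by simp, fun i hi => ⟨by simp [hi], hb i⟩⟩

theorem update_comp_of_forall {I U : Type*} [DecidableEq I] {f g : I → I} {a b : I} (ha : g a = b)
    (h : ∀ i, i ≠ a → g i = f i ∧ f i ≠ b) (x : I → U) (w : U) :
    Function.update (x ∘ f) a w = Function.update x b w ∘ g := by
  ext i
  by_cases hi : i = a
  · subst hi
    simp [ha]
  · simp [hi, (h i hi).1, (h i hi).2]

/-- The bijection that matches the extensions of `x` and `y` also matches those of `x ∘ f` and `y ∘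
f`, because each of the latter is a reindexed extension of the original tuple and the previous round
applies to it. -/
theorem wlColouring_reindex {i : ℕ} {x : Fin ℓ → V} {y : Fin ℓ → W}
    (h : wlColouring ℓ G χ i x = wlColouring ℓ H ψ i y) (f : Fin ℓ → Fin ℓ) :
    wlColouring ℓ G χ i (x ∘ f) = wlColouring ℓ H ψ i (y ∘ f) := by
  induction i generalizing x y f with
  | zero =>
    obtain ⟨h1, h2⟩ := Prod.mk.inj h
    obtain ⟨h2, h3⟩ := Prod.mk.inj h2
    exact Prod.ext (funext fun a => congrFun h1 (f a))
      (Prod.ext (funext₂ fun a b => congrFun (congrFun h2 (f a)) (f b))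
        (funext₂ fun a b => congrFun (congrFun h3 (f a)) (f b)))
  | succ i ih =>
    refine Prod.ext (ih (congrArg Prod.fst h) f) ?_
    obtain ⟨σ, hσ⟩ := exists_equiv_of_wlColouring_succ h
    have hmap : ∀ w, (fun a => wlColouring ℓ G χ i (Function.update (x ∘ f) a w)) =
        fun a => wlColouring ℓ H ψ i (Function.update (y ∘ f) a (σ w)) := fun w => by
      ext1 a
      obtain ⟨b, g, hga, hg⟩ := exists_update_comp f a
      rw [update_comp_of_forall hga hg, update_comp_of_forall hga hg]
      exact ih (hσ b w) g
    change (Finset.univ : Finset V).val.map _ = (Finset.univ : Finset W).val.map _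
    rw [← Finset.map_univ_equiv σ, Finset.map_val, Multiset.map_map]
    exact Multiset.map_congr rfl fun w _ => hmap w

theorem isStablePair_wlColouring {i : ℕ}
    (h : ∀ x y, wlColouring ℓ G χ i x = wlColouring ℓ H ψ i y →
      wlColouring ℓ G χ (i + 1) x = wlColouring ℓ H ψ (i + 1) y) :
    IsStablePair G χ H ψ (wlColouring ℓ G χ i) (wlColouring ℓ H ψ i) where
  colour e a := congrFun (Prod.mk.inj (wlColouring_zero_eq e)).1 a
  eq_iff e a b := iff_of_eq (congrFun (congrFun
    (Prod.mk.inj (Prod.mk.inj (wlColouring_zero_eq e)).2).1 a) b)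
  adj_iff e a b := iff_of_eq (congrFun (congrFun
    (Prod.mk.inj (Prod.mk.inj (wlColouring_zero_eq e)).2).2 a) b)
  extend e := exists_equiv_of_wlColouring_succ (h _ _ e)
  reindex e f := wlColouring_reindex e f

end WL

/-- Stable colourings can be transported to tuples over another index set. -/
theorem IsStablePair.comp_equiv {I J : Type*} [DecidableEq I] [DecidableEq J] {V : Type u}
    {W : Type v} {C : Type w} {T : Type*} {G : SimpleGraph V} {χ : V → C} {H : SimpleGraph W}
    {ψ : W → C} {c : (I → V) → T} {d : (I → W) → T} (h : IsStablePair G χ H ψ c d) (e : J ≃ I) :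
    IsStablePair G χ H ψ (fun x : J → V => c (x ∘ e.symm)) (fun y : J → W => d (y ∘ e.symm)) where
  colour q j := by simpa using h.colour q (e j)
  eq_iff q j j' := by simpa using h.eq_iff q (e j) (e j')
  adj_iff q j j' := by simpa using h.adj_iff q (e j) (e j')
  extend q := by
    obtain ⟨σ, hσ⟩ := h.extend q
    refine ⟨σ, fun j w => ?_⟩
    simpa [Function.update_comp_equiv] using hσ (e j) w
  reindex q f := by
    have := h.reindex q (e ∘ f ∘ e.symm)
    convert this using 2 <;> ext i <;> simp

/-! ### Existence of optimal decompositions and the conclusion -/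

theorem exists_decompositionTree {V : Type u} [Finite V] (X : Set V) (hX : X.Nonempty) :
    Nonempty (DecompositionTree X) := by
  induction X, X.toFinite using Set.Finite.induction_on with
  | empty => exact absurd hX Set.not_nonempty_empty
  | @insert s X hs _ ih =>
    rcases X.eq_empty_or_nonempty with rfl | hX
    · rw [insert_empty_eq]
      exact ⟨.leaf s⟩
    · obtain ⟨t⟩ := ih hX
      rw [Set.insert_eq]
      exact ⟨.node (.leaf s) t (Set.disjoint_singleton_left.mpr hs)⟩

theorem exists_decompositionTree_width_eq {V : Type u} [Fintype V] [Nonempty V]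
    (G : SimpleGraph V) : ∃ t : DecompositionTree (Set.univ : Set V), t.width G = rankWidth G := by
  obtain ⟨t⟩ := exists_decompositionTree (Set.univ : Set V) Set.univ_nonempty
  exact Nat.sInf_mem (s := {m | ∃ t : DecompositionTree (Set.univ : Set V), t.width G = m})
    ⟨_, t, rfl⟩

theorem theorem1 {V : Type u} {C : Type w} [Fintype V] (k : ℕ) (G : SimpleGraph V) (χ : V → C)
    (hG : rankWidth G ≤ k) : WLIdentifies.{u, v, w} (3 * k + 4) G χ := by
  intro W _ H ψ hiso
  by_contra hdist
  unfold WLDistinguishes at hdist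
  push Not at hdist
  apply hiso
  have hstable : WLStableAt (3 * k + 4) G χ H ψ (wlStableRound (3 * k + 4) G χ H ψ) := by
    unfold wlStableRound
    exact @Nat.find_spec _ (fun _ => Classical.propDecidable _) (exists_wlStableAt (3 * k + 4) G χ H ψ)
  generalize wlStableRound (3 * k + 4) G χ H ψ = r at hdist hstable
  have hpos : ∀ x, ∃ y, wlColouring (3 * k + 4) G χ r x = wlColouring (3 * k + 4) H ψ r y :=
    fun x => by
    have h1 : 0 < Set.ncard {z | wlColouring (3 * k + 4) G χ r z =
      wlColouring (3 * k + 4) G χ r x} := (Set.ncard_pos (Set.toFinite _)).mpr ⟨x, rfl⟩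
    rw [hdist, Set.ncard_pos (Set.toFinite _)] at h1
    obtain ⟨y, hy⟩ := h1
    exact ⟨y, hy.symm⟩
  -- The converse direction is needed only if `V` is empty: a vertex of `W` would give a tuple in
  -- `H`, hence one in `G`.
  have hpos' : ∀ y : Fin (3 * k + 4) → W, Nonempty (Fin (3 * k + 4) → V) := fun y => by
    have h1 : 0 < Set.ncard {z | wlColouring (3 * k + 4) H ψ r z =
      wlColouring (3 * k + 4) H ψ r y} := (Set.ncard_pos (Set.toFinite _)).mpr ⟨y, rfl⟩
    rw [← hdist, Set.ncard_pos (Set.toFinite _)] at h1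
    exact ⟨h1.choose⟩
  rcases isEmpty_or_nonempty V with hV | hV
  · have hW : IsEmpty W := ⟨fun w => by
      obtain ⟨x⟩ := hpos' fun _ => w
      exact hV.elim (x ⟨0, by omega⟩)⟩
    exact ⟨⟨Equiv.equivOfIsEmpty V W, fun {a} => hV.elim a⟩, fun a => hV.elim a⟩
  · obtain ⟨t, ht⟩ := exists_decompositionTree_width_eq G
    let e : Slot k ≃ Fin (3 * k + 4) := Fintype.equivFinOfCardEq (by simp)
    refine colouredIso_of_isStablePair
      ((isStablePair_wlColouring fun x y hxy => hstable (Sum.inl x) (Sum.inl y) hxy).comp_equiv e)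
      ((isStablePair_wlColouring fun x y hxy => hstable (Sum.inl x) (Sum.inr y) hxy).comp_equiv e)
      t (ht.trans_le hG) fun x => ?_
    obtain ⟨y, hy⟩ := hpos (x ∘ e.symm)
    refine ⟨y ∘ e, hy.trans ?_⟩
    congr 1
    ext i
    simp
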